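/- Let $n\ge 1$ and $1/N\in(-\infty,1/n]$ (so $N\in(-\infty,0)\cup[n,\infty]$). Let $\mu$ be a locally finite Borel measure on Euclidean space $\mathbb R^n$ with convex support $\Omega$, such that $(\Omega,|\cdot|,\mu)$ satisfies $\mathrm{CD}(0,N)$: $\mu=e^{-V(x)}\,dx$ on $\Omega$ with $V$ of class $C^2$ in the interior of $\Omega$ and $\nabla^2V-\frac1{N-n}\,dV\otimes dV\ge 0$ there ($V$ constant if $N=n$; $\nabla^2 V\ge 0$ if $N=\infty$). When $1/N=0$, read $Nx^{1/N}$ as $\log x$, and $\frac{N-1}{N}$, $\frac{N}{N-1}$ as $1$. Let $K\subset\Omega$ and $L\subset\mathbb R^n$ be strictly convex compact sets with non-empty interior and $C^2$ boundary. 1. The function $t\mapsto N\mu(K+tL)^{1/N}$ is concave on $\{t\ge 0:\mu(K+tL)>0\}$. If the origin is an interior point of $L$, it is concave on $[0,\infty)$. From now on the origin is an interior point of $L$. For every such $K$, and for every $K\subset\Omega$ admissible in item 3, the boundary measure $$\mu_L^+(K):=\lim_{t\to0+}\frac{\mu(K+tL)-\mu(K)}{t}\in[0,\infty]$$ exists.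 2. One has $$\mu_L^+(K)\ \ge\ \mu(K)^{\frac{N-1}N}\ \sup_{t>0}N\,\frac{\mu(K+tL)^{1/N}-\mu(K)^{1/N}}{t}.$$ In particular, if $\Omega-\Omega\subset DL$ with $0<D<\infty$ (the $L$-diameter of $\Omega$ is at most $D$), then $$\mu_L^+(K)\ \ge\ \frac ND\,\mu(K)^{\frac{N-1}N}\bigl(\mu(\Omega)^{1/N}-\mu(K)^{1/N}\bigr).$$ Alternatively, if $\mu(\Omega)=\infty$ and $N\in[n,\infty]$, then $$\mu_L^+(K)\ \ge\ \mu(K)^{\frac{N-1}N}\ \limsup_{t\to\infty}\frac{N\mu(tL)^{1/N}}{t}.$$ 3. Define the convex isoperimetric profile $$\mathcal I^c_L(v):=\inf\{\mu_L^+(K)\,:\,\mu(K)=v,\ K\in\mathcal K\},$$ where $\mathcal K$ is the class of compact convex sets $K\subset\Omega$ with non-empty interior whose boundary $\partial K$, taken in the space $\Omega$, is $C^2$ smooth with positive definite second fundamental form. That is, near each point $x\in K\cap\overline{\Omega\setminus K}$ the set $K$ is the trace on $\Omega$ of a sublevel set $\{f\le0\}$ of a $C^2$ function $f$ with $f(x)=0$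 and $\nabla f(x)\ne0$, and the second fundamental form of $\{f=0\}$ at $x$ with respect to $\nabla f/|\nabla f|$ is positive definite. If $N\neq1$ (which can fail only for $n=1$), the function $v\mapsto\mathcal I^c_L(v)^{\frac N{N-1}}/v$ is non-increasing on its domain $\{\mu(K):K\in\mathcal K\}$. -/

import Mathlib

open MeasureTheory Set Filter Topology
open scoped ENNReal Pointwise

namespace CDIsop

noncomputable section

/-- `ℝⁿ` with its Euclidean norm. -/
abbrev E (n : ℕ) : Type := EuclideanSpace ℝ (Fin n)

/-- The curvature-dimension condition `CD(0,N)` for `(Ω, |·|, μ)`, where `κ = 1/N`: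
`μ` has a density `exp (-V)` on `Ω` with `V` of class `C²`, and the generalized Ricci tensor
`∇²V - (1/(N-n)) dV ⊗ dV` is positive semi-definite. Here `1/(N-n) = κ/(1-nκ)`; this covers
`N = ∞` (`κ = 0`) and `N < 0` (`κ < 0`). For `N = n` the potential `V` has to be constant.
The boundary of the convex set `Ω` is Lebesgue-null, so only its interior matters. -/
def SatisfiesCDZero {n : ℕ} (κ : ℝ) (Ω : Set (E n)) (μ : Measure (E n)) : Prop :=
  ∃ V : E n → ℝ,
    ContDiffOn ℝ 2 V (interior Ω) ∧
    μ = ((volume : Measure (E n)).restrict (interior Ω)).withDensity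
          (fun x => ENNReal.ofReal (Real.exp (-V x))) ∧
    ((n : ℝ) * κ = 1 → ∃ c : ℝ, ∀ x ∈ interior Ω, V x = c) ∧
    ∀ x ∈ interior Ω, ∀ v : E n,
      0 ≤ fderiv ℝ (fderiv ℝ V) x v v - κ / (1 - n * κ) * (fderiv ℝ V x v) ^ 2

/-- `N x^{1/N}` as a function of `κ = 1/N`, with the usual convention that it means `log x`
when `1/N = 0`. -/
def nPow (κ x : ℝ) : ℝ := if κ = 0 then Real.log x else x ^ κ / κ

/-- The topological boundary of `K` as a subset of the space `Ω`. It is the usual boundary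
when `Ω` is the whole space. -/
def bdryIn {n : ℕ} (Ω K : Set (E n)) : Set (E n) :=
  Ω ∩ closure K ∩ closure (Ω \ K)

/-- `f` is a `C²` defining function of `K ⊆ Ω` on the neighbourhood `U` of the boundary
point `x`. -/
structure IsC2Defining {n : ℕ} (Ω K : Set (E n)) (x : E n) (U : Set (E n)) (f : E n → ℝ) :
    Prop where
  isOpen : IsOpen U
  mem : x ∈ U
  contDiffOn : ContDiffOn ℝ 2 f U
  eq_zero : f x = 0
  fderiv_ne_zero : fderiv ℝ f x ≠ 0
  eq_sublevel : K ∩ U = Ω ∩ {y | f y ≤ 0} ∩ U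

/-- The boundary of `K` in the space `Ω` is `C²` smooth. -/
def HasC2BoundaryIn {n : ℕ} (Ω K : Set (E n)) : Prop :=
  ∀ x ∈ bdryIn Ω K, ∃ U f, IsC2Defining Ω K x U f

/-- The second fundamental form at `x` of the hypersurface `{f = 0}` with respect to the normal
`ν = ∇f / |∇f|`: for tangent vectors `v, w`, `⟨∇_v ν, w⟩ = D²f(v, w) / |∇f|`. -/
def secondFF {n : ℕ} (f : E n → ℝ) (x v w : E n) : ℝ :=
  fderiv ℝ (fderiv ℝ f) x v w / ‖fderiv ℝ f x‖

/-- The boundary of `K` in the space `Ω` is `C²` smooth with `II > 0`. -/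
def HasC2PosBoundaryIn {n : ℕ} (Ω K : Set (E n)) : Prop :=
  ∀ x ∈ bdryIn Ω K, ∃ U f, IsC2Defining Ω K x U f ∧
    ∀ v : E n, v ≠ 0 → fderiv ℝ f x v = 0 → 0 < secondFF f x v v

/-- The boundary measure `μ⁺_L(K)`: the right derivative at `t = 0` of `t ↦ μ(K + tL)`, in the
wide sense. The lower limit makes it total; when `0 ∈ int L` it is a genuine limit (this is part
of the theorem). -/
def boundaryMeasure {n : ℕ} (μ : Measure (E n)) (L K : Set (E n)) : ℝ≥0∞ :=
  liminf (fun t : ℝ => (μ (K + t • L) - μ K) / ENNReal.ofReal t) (𝓝[>] 0)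

/-- The competitors in the convex isoperimetric profile: compact convex subsets of `Ω` with
non-empty interior whose boundary in the space `Ω` is `C²` smooth with `II > 0`. -/
structure IsCompetitor {n : ℕ} (Ω K : Set (E n)) : Prop where
  subset : K ⊆ Ω
  isCompact : IsCompact K
  convex : Convex ℝ K
  interior_nonempty : (interior K).Nonempty
  boundary : HasC2PosBoundaryIn Ω K

/-- The convex isoperimetric profile. -/
def convexProfile {n : ℕ} (μ : Measure (E n)) (Ω L : Set (E n)) (v : ℝ≥0∞) : ℝ≥0∞ :=
  ⨅ K ∈ {K : Set (E n) | IsCompetitor Ω K ∧ μ K = v}, boundaryMeasure μ L K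

/-- The domain of the convex isoperimetric profile: the values `μ(K)` of its competitors. -/
def profileDomain {n : ℕ} (μ : Measure (E n)) (Ω : Set (E n)) : Set ℝ≥0∞ :=
  {v | ∃ K : Set (E n), IsCompetitor Ω K ∧ μ K = v}

/-- A strictly convex compact set with non-empty interior and `C²` boundary (in `ℝⁿ`). -/
structure IsStrictC2Body {n : ℕ} (K : Set (E n)) : Prop where
  isCompact : IsCompact K
  strictConvex : StrictConvex ℝ K
  interior_nonempty : (interior K).Nonempty
  boundary : HasC2BoundaryIn univ K

end

end CDIsop

/-!
Under `CD(0, N)` the density of `μ` on the convex set `Ω` is `1/(N-n)`-concave: this is the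
condition `∇²V ≥ (1/(N-n)) dV ⊗ dV` read along segments (`powMean_exp_neg_le`). The
Borell–Brascamp–Lieb inequality turns it into a Brunn–Minkowski inequality for `μ`: the function
`N μ^{1/N}` is concave along convex combinations of compact sets of positive measure
(`brunn_minkowski`). Since `K` and `L` are convex, `K + tL` interpolates linearly in `t`, which gives
the concavity of `φ(t) = N μ(K + tL)^{1/N}`. The difference quotients of a concave function increase
as `t` decreases to `0`, so the boundary measure exists as a limit and equals
`μ(K)^{(N-1)/N} sup_{t>0} (φ(t) - φ(0))/t` (`boundaryMeasure_eq`); the isoperimetric inequalities are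
lower bounds for this supremum.

The Borell–Brascamp–Lieb inequality is proved on the line by comparing superlevel sets and in `ℝⁿ`
by induction on the dimension. It is stated with power means of finite nonzero order, and the
remaining orders `N = n` and `N = ∞` are limits: `CD(0, N)` implies the condition for every
parameter smaller than `1/N`.

For the profile, let `K` be a competitor and `v > μ(K)` the measure of another one. The set
`(K + tL) ∩ Ω` with `μ(K + tL) = v` has a boundary measure that is small enough, but its boundary in
`Ω` need not be `C²` with positive curvature: `L` may have points of zero curvature, and the corners
of `K` on `∂Ω` may become visible. It is replaced by the trace on `Ω` of a smooth strictly convex body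
`M` with `K + sL ⊆ M` and `μ(M) = v`, where `s < t` is close to `t`. No convergence of boundary
measures is needed: for `r > 0` the combination of `K` and `M + rL` with weights `r/(s+r)` and
`s/(s+r)` lies in `M`, so the Brunn–Minkowski inequality bounds the growth rate of `M` by the mean
slope `(N v^{1/N} - N μ(K)^{1/N})/s` (`nPow_growth_le`). Letting `s → t`, concavity bounds it by
`φ'(0)`, which is the claimed monotonicity (`antitoneOn_convexProfile`).
-/

namespace CDIsop

/-! ### Power means -/

/-- The weighted power mean of order `α ≠ 0` of two positive numbers, with weights `1 - s`
and `s`. -/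
noncomputable def powMean (s α a b : ℝ) : ℝ := ((1 - s) * a ^ α + s * b ^ α) ^ (1 / α)

section PowMean

variable {s α a b c a' b' : ℝ}

lemma powMean_sum_pos (hs : s ∈ Ioo (0 : ℝ) 1) (ha : 0 < a) (hb : 0 < b) :
    0 < (1 - s) * a ^ α + s * b ^ α := by
  have := sub_pos.2 hs.2
  have := hs.1
  positivity

lemma powMean_pos (hs : s ∈ Ioo (0 : ℝ) 1) (ha : 0 < a) (hb : 0 < b) : 0 < powMean s α a b :=
  Real.rpow_pos_of_pos (powMean_sum_pos hs ha hb) _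

lemma powMean_mono (hs : s ∈ Ioo (0 : ℝ) 1) (ha : 0 < a) (hb : 0 < b) (haa : a ≤ a')
    (hbb : b ≤ b') : powMean s α a b ≤ powMean s α a' b' := by
  have h1 := sub_pos.2 hs.2
  have h2 := hs.1
  unfold powMean
  rcases le_total 0 α with h | h
  · have := powMean_sum_pos (α := α) hs ha hb
    have := Real.rpow_le_rpow ha.le haa h
    have := Real.rpow_le_rpow hb.le hbb h
    apply Real.rpow_le_rpow (by positivity) _ (by positivity)
    gcongr
  · have := powMean_sum_pos (α := α) hs (ha.trans_le haa) (hb.trans_le hbb)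
    have := Real.rpow_le_rpow_of_nonpos ha haa h
    have := Real.rpow_le_rpow_of_nonpos hb hbb h
    apply Real.rpow_le_rpow_of_nonpos (by positivity) _ (one_div_nonpos.2 h)
    gcongr

lemma powMean_smul (hα : α ≠ 0) (hs : s ∈ Ioo (0 : ℝ) 1) (hc : 0 < c) (ha : 0 < a) (hb : 0 < b) :
    powMean s α (c * a) (c * b) = c * powMean s α a b := by
  unfold powMean
  rw [Real.mul_rpow hc.le ha.le, Real.mul_rpow hc.le hb.le,
    show (1 - s) * (c ^ α * a ^ α) + s * (c ^ α * b ^ α)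
      = c ^ α * ((1 - s) * a ^ α + s * b ^ α) by ring,
    Real.mul_rpow (by positivity) (powMean_sum_pos hs ha hb).le, ← Real.rpow_mul hc.le,
    mul_one_div_cancel hα, Real.rpow_one]

/-- Hölder's inequality for two weighted terms. -/
lemma weighted_holder_two {θ u₁ u₂ v₁ v₂ : ℝ} (hs : s ∈ Ioo (0 : ℝ) 1) (hθ : θ ∈ Ioo (0 : ℝ) 1)
    (hu₁ : 0 < u₁) (hu₂ : 0 < u₂) (hv₁ : 0 < v₁) (hv₂ : 0 < v₂) :
    (1 - s) * (u₁ ^ θ * v₁ ^ (1 - θ)) + s * (u₂ ^ θ * v₂ ^ (1 - θ)) ≤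
      ((1 - s) * u₁ + s * u₂) ^ θ * ((1 - s) * v₁ + s * v₂) ^ (1 - θ) := by
  have h1 := sub_pos.2 hs.2
  have h2 := hs.1
  have hθ1 := sub_pos.2 hθ.2
  set U := (1 - s) * u₁ + s * u₂ with hU
  set V := (1 - s) * v₁ + s * v₂ with hV
  have hU0 : 0 < U := by positivity
  have hV0 : 0 < V := by positivity
  have key : ∀ u v : ℝ, 0 < u → 0 < v →
      u ^ θ * v ^ (1 - θ) ≤ (θ * (u / U) + (1 - θ) * (v / V)) * (U ^ θ * V ^ (1 - θ)) := by
    intro u v hu hv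
    have := Real.geom_mean_le_arith_mean2_weighted hθ.1.le hθ1.le (div_pos hu hU0).le
      (div_pos hv hV0).le (by ring)
    rw [Real.div_rpow hu.le hU0.le, Real.div_rpow hv.le hV0.le, div_mul_div_comm,
      div_le_iff₀ (by positivity)] at this
    exact this
  have k1 := mul_le_mul_of_nonneg_left (key u₁ v₁ hu₁ hv₁) h1.le
  have k2 := mul_le_mul_of_nonneg_left (key u₂ v₂ hu₂ hv₂) h2.le
  have e : (1 - s) * (θ * (u₁ / U) + (1 - θ) * (v₁ / V)) +
      s * (θ * (u₂ / U) + (1 - θ) * (v₂ / V)) = 1 := by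
    have : θ * (((1 - s) * u₁ + s * u₂) / U) + (1 - θ) * (((1 - s) * v₁ + s * v₂) / V) = 1 := by
      rw [← hU, ← hV, div_self hU0.ne', div_self hV0.ne']; ring
    linear_combination this
  calc _ ≤ ((1 - s) * (θ * (u₁ / U) + (1 - θ) * (v₁ / V)) +
      s * (θ * (u₂ / U) + (1 - θ) * (v₂ / V))) * (U ^ θ * V ^ (1 - θ)) := by linarith
    _ = _ := by rw [e, one_mul]

/-- The Hölder inequality `M_{α/(1+α)}(F x, G y) ≤ M_α(F, G) M₁(x, y)` for power means, valid
for all `α > -1`: for `α < 0` it is the reverse Hölder inequality. -/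
lemma powMean_mul_le {F G x y : ℝ} (hs : s ∈ Ioo (0 : ℝ) 1) (hα : α ≠ 0) (hα1 : 0 < 1 + α)
    (hF : 0 < F) (hG : 0 < G) (hx : 0 < x) (hy : 0 < y) :
    powMean s (α / (1 + α)) (F * x) (G * y) ≤ powMean s α F G * ((1 - s) * x + s * y) := by
  have h1 := sub_pos.2 hs.2
  have h2 := hs.1
  have hS : 0 < (1 - s) * x + s * y := by positivity
  have hSF := powMean_sum_pos (α := α) hs hF hG
  have hSγ := powMean_sum_pos (α := α / (1 + α)) hs (mul_pos hF hx) (mul_pos hG hy)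
  rcases hα.lt_or_gt with h | h
  · have H := weighted_holder_two (θ := 1 + α) hs ⟨hα1, by linarith⟩
      (Real.rpow_pos_of_pos (mul_pos hF hx) (α / (1 + α)))
      (Real.rpow_pos_of_pos (mul_pos hG hy) (α / (1 + α))) hx hy
    have e : ∀ F x : ℝ, 0 < F → 0 < x →
        ((F * x) ^ (α / (1 + α))) ^ (1 + α) * x ^ (1 - (1 + α)) = F ^ α := by
      intro F x hF hx
      rw [← Real.rpow_mul (by positivity), div_mul_cancel₀ _ hα1.ne', Real.mul_rpow hF.le hx.le,
        mul_assoc, ← Real.rpow_add hx, show α + (1 - (1 + α)) = 0 by ring, Real.rpow_zero, mul_one]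
    rw [e F x hF hx, e G y hG hy] at H
    have H2 := Real.rpow_le_rpow_of_nonpos hSF H (one_div_nonpos.2 h.le)
    rw [Real.mul_rpow (by positivity) (by positivity), ← Real.rpow_mul hSγ.le,
      ← Real.rpow_mul hS.le, show (1 - (1 + α)) * (1 / α) = -1 by field_simp; ring,
      Real.rpow_neg_one, show (1 + α) * (1 / α) = 1 / (α / (1 + α)) by field_simp,
      ← div_eq_mul_inv, div_le_iff₀ hS] at H2
    exact H2
  · have H := weighted_holder_two (θ := 1 / (1 + α)) hs
      ⟨by positivity, by rw [div_lt_one hα1]; linarith⟩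
      (Real.rpow_pos_of_pos hF α) (Real.rpow_pos_of_pos hG α) hx hy
    have e' : 1 - 1 / (1 + α) = α / (1 + α) := by field_simp; ring
    have e : ∀ F x : ℝ, 0 < F → 0 < x →
        (F ^ α) ^ (1 / (1 + α)) * x ^ (1 - 1 / (1 + α)) = (F * x) ^ (α / (1 + α)) := by
      intro F x hF hx
      rw [e', ← Real.rpow_mul hF.le, mul_one_div, Real.mul_rpow hF.le hx.le]
    rw [e F x hF hx, e G y hG hy] at H
    have H2 := Real.rpow_le_rpow hSγ.le H (show 0 ≤ 1 / (α / (1 + α)) by positivity)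
    rw [Real.mul_rpow (Real.rpow_nonneg hSF.le _) (Real.rpow_nonneg hS.le _),
      ← Real.rpow_mul hSF.le,
      ← Real.rpow_mul hS.le, e', show 1 / (1 + α) * (1 / (α / (1 + α))) = 1 / α by field_simp,
      mul_one_div_cancel (by positivity), Real.rpow_one] at H2
    exact H2

end PowMean

/-! ### The Brunn–Minkowski inequality on the line -/

lemma volume_add_volume_le_of_isCompact {A B : Set ℝ} (hA : IsCompact A) (hB : IsCompact B)
    (hA0 : A.Nonempty) (hB0 : B.Nonempty) : volume A + volume B ≤ volume (A + B) := by
  -- The translates `inf B + A` and `sup A + B` meet in at most one point.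
  have h1 : volume ((fun x => sInf B + x) '' A) = volume A := by
    rw [image_add_left, measure_preimage_add]
  have h2 : volume ((fun x => sSup A + x) '' B) = volume B := by
    rw [image_add_left, measure_preimage_add]
  have hm : MeasurableSet ((fun x => sSup A + x) '' B) :=
    (hB.image (continuous_const.add continuous_id)).measurableSet
  have hi : volume ((fun x => sInf B + x) '' A ∩ (fun x => sSup A + x) '' B) = 0 := by
    refine measure_mono_null (t := {sSup A + sInf B}) ?_ (by simp)
    rintro _ ⟨⟨x, hx, rfl⟩, ⟨y, hy, hxy⟩⟩
    have := le_csSup hA.bddAbove hx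
    have := csInf_le hB.bddBelow hy
    simp only [mem_singleton_iff] at *
    linarith
  rw [← h1, ← h2, ← measure_union_add_inter _ hm, hi, add_zero]
  apply measure_mono
  rintro _ (⟨x, hx, rfl⟩ | ⟨y, hy, rfl⟩)
  · exact ⟨x, hx, sInf B, hB.sInf_mem hB0, add_comm _ _⟩
  · exact ⟨sSup A, hA.sSup_mem hA0, y, hy, rfl⟩

lemma volume_mix_le {A B S : Set ℝ} {s : ℝ} (hs : s ∈ Ioo (0 : ℝ) 1) (hA : MeasurableSet A)
    (hB : MeasurableSet B) (hA0 : A.Nonempty) (hB0 : B.Nonempty)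
    (hS : ∀ x ∈ A, ∀ y ∈ B, (1 - s) * x + s * y ∈ S) :
    ENNReal.ofReal (1 - s) * volume A + ENNReal.ofReal s * volume B ≤ volume S := by
  have h1 := sub_pos.2 hs.2
  have hc : ∀ A' B' : Set ℝ, A' ⊆ A ∧ IsCompact A' → B' ⊆ B ∧ IsCompact B' →
      ENNReal.ofReal (1 - s) * volume A' + ENNReal.ofReal s * volume B' ≤ volume S := by
    rintro A' B' ⟨hA', hcA⟩ ⟨hB', hcB⟩
    obtain ⟨x, hx⟩ := hA0
    obtain ⟨y, hy⟩ := hB0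
    have key := volume_add_volume_le_of_isCompact ((hcA.insert x).smul (1 - s))
      ((hcB.insert y).smul s) ((insert_nonempty _ _).smul_set) ((insert_nonempty _ _).smul_set)
    simp only [Measure.addHaar_smul, Module.finrank_self, pow_one, abs_of_pos h1,
      abs_of_pos hs.1] at key
    calc _ ≤ ENNReal.ofReal (1 - s) * volume (insert x A') +
          ENNReal.ofReal s * volume (insert y B') := by gcongr <;> exact subset_insert _ _
      _ ≤ _ := key
      _ ≤ _ := by
        apply measure_mono
        rintro _ ⟨_, ⟨u, hu, rfl⟩, _, ⟨v, hv, rfl⟩, rfl⟩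
        exact hS u (insert_subset hx hA' hu) v (insert_subset hy hB' hv)
  rw [hA.measure_eq_iSup_isCompact, hB.measure_eq_iSup_isCompact]
  simp only [ENNReal.mul_iSup]
  simp only [iSup_and']
  exact ENNReal.biSup_add_biSup_le' ⟨∅, by simp⟩ ⟨∅, by simp⟩ fun i hi j hj => hc i j hi hj

/-! ### The Borell–Brascamp–Lieb inequality -/

/-- The hypothesis of the Borell–Brascamp–Lieb inequality: `h((1-s)x + sy) ≥ M_α(f(x), g(y))`
whenever `f(x), g(y) > 0`. Bounding `f(x)` and `g(y)` from below by real numbers allows infinite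
values without power means in `[0, ∞]`. -/
def PowMeanLE {X : Type*} [AddCommGroup X] [Module ℝ X] (s α : ℝ) (f g h : X → ℝ≥0∞) : Prop :=
  ∀ x y : X, ∀ a b : ℝ, 0 < a → 0 < b → ENNReal.ofReal a < f x → ENNReal.ofReal b < g y →
    ENNReal.ofReal (powMean s α a b) ≤ h ((1 - s) • x + s • y)

lemma lintegral_div_le_lintegral_meas_lt {f : ℝ → ℝ≥0∞} (hf : Measurable f) {F : ℝ} (hF : 0 < F)
    (hfF : ∀ x, f x ≤ ENNReal.ofReal F) :
    (∫⁻ x, f x) / ENNReal.ofReal F ≤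
      ∫⁻ τ in Ioo (0 : ℝ) 1, volume {x | ENNReal.ofReal (τ * F) < f x} := by
  have hfin : ∀ x, f x ≠ ∞ := fun x => ((hfF x).trans_lt ENNReal.ofReal_lt_top).ne
  have e : (∫⁻ x, f x) / ENNReal.ofReal F = ∫⁻ x, ENNReal.ofReal ((f x).toReal / F) := by
    rw [ENNReal.div_eq_inv_mul, ← lintegral_const_mul _ hf]
    refine lintegral_congr fun x => ?_
    rw [ENNReal.ofReal_div_of_pos hF, ENNReal.ofReal_toReal (hfin x), ENNReal.div_eq_inv_mul]
  rw [e, lintegral_eq_lintegral_meas_lt _ (Eventually.of_forall fun x => by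
    have : 0 ≤ (f x).toReal := ENNReal.toReal_nonneg
    positivity) (hf.ennreal_toReal.div_const F).aemeasurable]
  rw [← lintegral_indicator measurableSet_Ioi, ← lintegral_indicator measurableSet_Ioo]
  refine lintegral_mono fun τ => ?_
  by_cases h0 : 0 < τ
  swap
  · rw [indicator_of_notMem (by simpa using h0)]; exact zero_le
  by_cases h1 : τ < 1
  · rw [indicator_of_mem (by simpa using h0), indicator_of_mem (by simp [h0, h1])]
    refine measure_mono fun x hx => ?_
    simp only [mem_ofPred_eq, lt_div_iff₀ hF] at hx ⊢
    rwa [ENNReal.ofReal_lt_iff_lt_toReal (by positivity) (hfin x)]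
  · rw [indicator_of_mem (by simpa using h0)]
    refine le_of_eq_of_le (measure_mono_null (t := ∅) (fun x hx => h1 ?_) measure_empty) zero_le
    simp only [mem_ofPred_eq] at hx
    refine hx.trans_le ?_
    rw [div_le_one hF]
    exact ENNReal.toReal_le_of_le_ofReal hF.le (hfF x)

lemma lintegral_meas_le_le_lintegral_div {h : ℝ → ℝ≥0∞} (hh : Measurable h) {M : ℝ} (hM : 0 < M) :
    ∫⁻ τ in Ioo (0 : ℝ) 1, volume {x | ENNReal.ofReal (τ * M) ≤ h x} ≤
      (∫⁻ x, h x) / ENNReal.ofReal M := by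
  set k : ℝ → ℝ≥0∞ := fun x => min (h x) (ENNReal.ofReal M) with hk
  have hkm : Measurable k := hh.min measurable_const
  have hfin : ∀ x, k x ≠ ∞ := fun x => ((min_le_right _ _).trans_lt ENNReal.ofReal_lt_top).ne
  have e : (∫⁻ x, k x) / ENNReal.ofReal M = ∫⁻ x, ENNReal.ofReal ((k x).toReal / M) := by
    rw [ENNReal.div_eq_inv_mul, ← lintegral_const_mul _ hkm]
    refine lintegral_congr fun x => ?_
    rw [ENNReal.ofReal_div_of_pos hM, ENNReal.ofReal_toReal (hfin x), ENNReal.div_eq_inv_mul]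
  calc _ ≤ (∫⁻ x, k x) / ENNReal.ofReal M := ?_
    _ ≤ _ := by gcongr; exact min_le_left _ _
  rw [e, lintegral_eq_lintegral_meas_le _ (Eventually.of_forall fun x => by
    have : 0 ≤ (k x).toReal := ENNReal.toReal_nonneg
    positivity) (hkm.ennreal_toReal.div_const M).aemeasurable]
  rw [← lintegral_indicator measurableSet_Ioi, ← lintegral_indicator measurableSet_Ioo]
  refine lintegral_mono fun τ => ?_
  by_cases h0 : 0 < τ
  swap
  · rw [indicator_of_notMem (by simp [h0])]; exact zero_le
  by_cases h1 : τ < 1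
  · rw [indicator_of_mem (by simp [h0, h1]), indicator_of_mem (by simpa using h0)]
    refine measure_mono fun x hx => ?_
    simp only [mem_ofPred_eq, le_div_iff₀ hM] at hx ⊢
    rw [← ENNReal.ofReal_le_iff_le_toReal (hfin x)]
    refine le_min hx (ENNReal.ofReal_le_ofReal ?_)
    nlinarith
  · rw [indicator_of_notMem (by simp [h1])]; exact zero_le

/-- Truncation at a high level makes the supremum finite and positive without bringing the integral
down to `a`. -/
lemma exists_truncation {f : ℝ → ℝ≥0∞} (hf : Measurable f) {a : ℝ}
    (h : ENNReal.ofReal a < ∫⁻ x, f x) :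
    ∃ (f' : ℝ → ℝ≥0∞) (F : ℝ), Measurable f' ∧ (∀ x, f' x ≤ f x) ∧ 0 < F ∧
      (⨆ x, f' x) = ENNReal.ofReal F ∧ ENNReal.ofReal a < ∫⁻ x, f' x := by
  have e : ∫⁻ x, f x = ⨆ k : ℕ, ∫⁻ x, min (f x) k := by
    rw [← lintegral_iSup (fun k => hf.min measurable_const)]
    · refine lintegral_congr fun x => ?_
      rw [← inf_iSup_eq, ENNReal.iSup_natCast, inf_top_eq]
    · intro i j hij x
      exact min_le_min le_rfl (by exact_mod_cast hij)
  rw [e, lt_iSup_iff] at h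
  obtain ⟨k, hk⟩ := h
  have hle : (⨆ x, min (f x) k) ≤ (k : ℝ≥0∞) := iSup_le fun x => min_le_right _ _
  have hne : (⨆ x, min (f x) k) ≠ ∞ := (hle.trans_lt (by simp)).ne
  refine ⟨fun x => min (f x) k, (⨆ x, min (f x) k).toReal, hf.min measurable_const,
    fun x => min_le_left _ _, ENNReal.toReal_pos ?_ hne, (ENNReal.ofReal_toReal hne).symm, hk⟩
  intro h0
  have : ∫⁻ x, min (f x) k = 0 := by
    rw [← lintegral_zero]
    refine lintegral_congr fun x => le_antisymm ?_ zero_le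
    rw [← h0]; exact le_iSup (fun x => min (f x) (k : ℝ≥0∞)) x
  rw [this] at hk
  exact not_lt_zero hk

/-- The one-dimensional Borell–Brascamp–Lieb inequality. Once `f` and `g` are truncated and divided
by their suprema, the superlevel sets of `h` contain the mixtures of those of `f` and `g`; the
Brunn–Minkowski inequality on the line is integrated over the levels, and Hölder's inequality
restores the suprema. -/
theorem borell_brascamp_lieb_real {s α : ℝ} (hs : s ∈ Ioo (0 : ℝ) 1) (hα : α ≠ 0)
    (hα1 : 0 < 1 + α) {f g h : ℝ → ℝ≥0∞} (hf : Measurable f) (hg : Measurable g)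
    (hh : Measurable h) (H : PowMeanLE s α f g h) {a b : ℝ} (ha : 0 < a) (hb : 0 < b)
    (haf : ENNReal.ofReal a < ∫⁻ x, f x) (hbg : ENNReal.ofReal b < ∫⁻ x, g x) :
    ENNReal.ofReal (powMean s (α / (1 + α)) a b) ≤ ∫⁻ x, h x := by
  have hs1 := sub_pos.2 hs.2
  obtain ⟨f', F, hf', hff', hF, hFs, haf'⟩ := exists_truncation hf haf
  obtain ⟨g', G, hg', hgg', hG, hGs, hbg'⟩ := exists_truncation hg hbg
  set M := powMean s α F G with hMdef
  have hM : 0 < M := powMean_pos hs hF hG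
  have hlev : ∀ τ ∈ Ioo (0 : ℝ) 1,
      ENNReal.ofReal (1 - s) * volume {x | ENNReal.ofReal (τ * F) < f' x} +
        ENNReal.ofReal s * volume {x | ENNReal.ofReal (τ * G) < g' x} ≤
      volume {x | ENNReal.ofReal (τ * M) ≤ h x} := by
    intro τ hτ
    have hne : ∀ (k : ℝ → ℝ≥0∞) (K : ℝ), 0 < K → (⨆ x, k x) = ENNReal.ofReal K →
        {x | ENNReal.ofReal (τ * K) < k x}.Nonempty := by
      intro k K hK hk
      have : ENNReal.ofReal (τ * K) < ⨆ x, k x := by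
        rw [hk, ENNReal.ofReal_lt_ofReal_iff hK]
        nlinarith [hτ.2]
      exact lt_iSup_iff.1 this
    refine volume_mix_le hs (measurableSet_lt measurable_const hf')
      (measurableSet_lt measurable_const hg') (hne f' F hF hFs) (hne g' G hG hGs) ?_
    intro x hx y hy
    have := H x y (τ * F) (τ * G) (mul_pos hτ.1 hF) (mul_pos hτ.1 hG)
      (lt_of_lt_of_le hx (hff' x)) (lt_of_lt_of_le hy (hgg' y))
    rwa [powMean_smul hα hs hτ.1 hF hG] at this
  have hanti : ∀ (k : ℝ → ℝ≥0∞) (K : ℝ), 0 < K →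
      Measurable fun τ : ℝ => volume {x | ENNReal.ofReal (τ * K) < k x} := by
    intro k K hK
    apply Antitone.measurable
    intro τ τ' hττ
    refine measure_mono fun x hx => lt_of_le_of_lt (ENNReal.ofReal_le_ofReal ?_) hx
    gcongr
  have hmain : ENNReal.ofReal (1 - s) * ((∫⁻ x, f' x) / ENNReal.ofReal F) +
      ENNReal.ofReal s * ((∫⁻ x, g' x) / ENNReal.ofReal G) ≤ (∫⁻ x, h x) / ENNReal.ofReal M := by
    calc _ ≤ ENNReal.ofReal (1 - s) *
            (∫⁻ τ in Ioo (0 : ℝ) 1, volume {x | ENNReal.ofReal (τ * F) < f' x}) +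
          ENNReal.ofReal s *
            (∫⁻ τ in Ioo (0 : ℝ) 1, volume {x | ENNReal.ofReal (τ * G) < g' x}) := by
          gcongr
          · exact lintegral_div_le_lintegral_meas_lt hf' hF fun x => hFs ▸ le_iSup f' x
          · exact lintegral_div_le_lintegral_meas_lt hg' hG fun x => hGs ▸ le_iSup g' x
      _ = ∫⁻ τ in Ioo (0 : ℝ) 1,
            (ENNReal.ofReal (1 - s) * volume {x | ENNReal.ofReal (τ * F) < f' x} +
            ENNReal.ofReal s * volume {x | ENNReal.ofReal (τ * G) < g' x}) := by
          rw [lintegral_add_left ((hanti f' F hF).const_mul _),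
            lintegral_const_mul _ (hanti f' F hF), lintegral_const_mul _ (hanti g' G hG)]
      _ ≤ ∫⁻ τ in Ioo (0 : ℝ) 1, volume {x | ENNReal.ofReal (τ * M) ≤ h x} :=
          setLIntegral_mono' measurableSet_Ioo hlev
      _ ≤ _ := lintegral_meas_le_le_lintegral_div hh hM
  have hholder := powMean_mul_le hs hα hα1 hF hG (div_pos ha hF) (div_pos hb hG)
  rw [mul_div_cancel₀ _ hF.ne', mul_div_cancel₀ _ hG.ne', ← hMdef] at hholder
  calc _ ≤ ENNReal.ofReal (M * ((1 - s) * (a / F) + s * (b / G))) :=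
        ENNReal.ofReal_le_ofReal hholder
    _ = ENNReal.ofReal M * (ENNReal.ofReal (1 - s) * (ENNReal.ofReal a / ENNReal.ofReal F) +
          ENNReal.ofReal s * (ENNReal.ofReal b / ENNReal.ofReal G)) := by
        rw [ENNReal.ofReal_mul hM.le, ENNReal.ofReal_add (by positivity)
          (mul_pos hs.1 (by positivity)).le, ENNReal.ofReal_mul hs1.le, ENNReal.ofReal_mul hs.1.le,
          ENNReal.ofReal_div_of_pos hF, ENNReal.ofReal_div_of_pos hG]
    _ ≤ ENNReal.ofReal M * ((∫⁻ x, h x) / ENNReal.ofReal M) := by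
        refine mul_le_mul_right ((?_ : _ ≤ _).trans hmain) _
        gcongr
    _ = _ := ENNReal.mul_div_cancel (by simpa using hM) ENNReal.ofReal_ne_top

/-- The Borell–Brascamp–Lieb inequality in dimension `n`, by induction on `n`: the integrals over
hyperplanes inherit the hypothesis with `α / (1 + nα)` in place of `α`. -/
theorem borell_brascamp_lieb_pi {s : ℝ} (hs : s ∈ Ioo (0 : ℝ) 1) (n : ℕ) {α : ℝ} (hα : α ≠ 0)
    (hα1 : 0 < 1 + n * α) {f g h : (Fin n → ℝ) → ℝ≥0∞} (hf : Measurable f) (hg : Measurable g)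
    (hh : Measurable h) (H : PowMeanLE s α f g h) {a b : ℝ} (ha : 0 < a) (hb : 0 < b)
    (haf : ENNReal.ofReal a < ∫⁻ x, f x) (hbg : ENNReal.ofReal b < ∫⁻ x, g x) :
    ENNReal.ofReal (powMean s (α / (1 + n * α)) a b) ≤ ∫⁻ x, h x := by
  induction n generalizing a b with
  | zero =>
    simp only [Measure.volume_pi_eq_dirac (0 : Fin 0 → ℝ), lintegral_dirac] at *
    simpa using H 0 0 a b ha hb haf hbg
  | succ n ih =>
    have he : ((MeasurableEquiv.piFinSuccAbove (fun _ => ℝ) (0 : Fin (n + 1))).symm :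
        ℝ × (Fin n → ℝ) → Fin (n + 1) → ℝ) = fun p => Fin.cons p.1 p.2 := by
      funext p
      exact Fin.insertNth_zero' p.1 p.2
    have hcons : Measurable fun p : ℝ × (Fin n → ℝ) => (Fin.cons p.1 p.2 : Fin (n + 1) → ℝ) :=
      he ▸ (MeasurableEquiv.piFinSuccAbove (fun _ => ℝ) (0 : Fin (n + 1))).symm.measurable
    have hint : ∀ {k : (Fin (n + 1) → ℝ) → ℝ≥0∞}, Measurable k →
        ∫⁻ x, k x = ∫⁻ t : ℝ, ∫⁻ z : Fin n → ℝ, k (Fin.cons t z) := by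
      intro k hk
      rw [← ((volume_preserving_piFinSuccAbove (fun _ => ℝ) (0 : Fin (n + 1))).symm _).lintegral_comp
        hk, he]
      exact lintegral_prod _ (hk.comp hcons).aemeasurable
    have hmeas : ∀ {k : (Fin (n + 1) → ℝ) → ℝ≥0∞}, Measurable k →
        Measurable fun t : ℝ => ∫⁻ z : Fin n → ℝ, k (Fin.cons t z) :=
      fun hk => (hk.comp hcons).lintegral_prod_right'
    have hmeas' : ∀ {k : (Fin (n + 1) → ℝ) → ℝ≥0∞}, Measurable k → ∀ t : ℝ,
        Measurable fun z : Fin n → ℝ => k (Fin.cons t z) :=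
      fun hk t => (hk.comp hcons).comp measurable_prodMk_left
    push_cast at hα1
    have hn : (0 : ℝ) ≤ n := n.cast_nonneg
    have hα2 : 0 < 1 + n * α := by
      rcases hα.lt_or_gt with h | h
      · linarith
      · positivity
    rw [hint hf] at haf
    rw [hint hg] at hbg
    rw [hint hh]
    have e : α / (1 + (n + 1 : ℕ) * α) = α / (1 + n * α) / (1 + α / (1 + n * α)) := by
      push_cast
      rw [div_div, mul_add, mul_one, mul_div_cancel₀ _ hα2.ne']
      ring
    rw [e]
    refine borell_brascamp_lieb_real hs (div_ne_zero hα hα2.ne') ?_ (hmeas hf) (hmeas hg)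
      (hmeas hh) ?_ ha hb haf hbg
    · have : 1 + α / (1 + n * α) = (1 + (n + 1) * α) / (1 + n * α) := by
        rw [eq_div_iff hα2.ne', add_mul, div_mul_cancel₀ _ hα2.ne']; ring
      rw [this]
      positivity
    · intro t t' a b ha hb hat hbt
      refine ih hα2 (hmeas' hf t) (hmeas' hg t') (hmeas' hh _) ?_ ha hb hat hbt
      intro z z' a b ha hb haz hbz
      convert H _ _ a b ha hb haz hbz using 2
      ext i
      refine Fin.cases ?_ (fun j => ?_) i <;> simp

theorem borell_brascamp_lieb_euclidean {s : ℝ} (hs : s ∈ Ioo (0 : ℝ) 1) {n : ℕ} {α : ℝ}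
    (hα : α ≠ 0) (hα1 : 0 < 1 + n * α) {f g h : E n → ℝ≥0∞} (hf : Measurable f)
    (hg : Measurable g) (hh : Measurable h) (H : PowMeanLE s α f g h) {a b : ℝ} (ha : 0 < a)
    (hb : 0 < b) (haf : ENNReal.ofReal a < ∫⁻ x, f x) (hbg : ENNReal.ofReal b < ∫⁻ x, g x) :
    ENNReal.ofReal (powMean s (α / (1 + n * α)) a b) ≤ ∫⁻ x, h x := by
  have hmp := PiLp.volume_preserving_toLp (Fin n)
  rw [← hmp.lintegral_comp hf] at haf
  rw [← hmp.lintegral_comp hg] at hbg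
  rw [← hmp.lintegral_comp hh]
  exact borell_brascamp_lieb_pi hs n hα hα1 (hf.comp hmp.measurable) (hg.comp hmp.measurable)
    (hh.comp hmp.measurable) (fun x y a b ha hb hx hy => H _ _ a b ha hb hx hy) ha hb haf hbg

/-! ### Concavity of powers of the density -/

lemma powMean_le_iff {s α a b r : ℝ} (hs : s ∈ Ioo (0 : ℝ) 1) (hα : α ≠ 0) (ha : 0 < a)
    (hb : 0 < b) (hr : 0 < r) :
    powMean s α a b ≤ r ↔ (1 - s) * (a ^ α / α) + s * (b ^ α / α) ≤ r ^ α / α := by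
  have hS := powMean_sum_pos (α := α) hs ha hb
  rw [show (1 - s) * (a ^ α / α) + s * (b ^ α / α) = ((1 - s) * a ^ α + s * b ^ α) / α by ring]
  unfold powMean
  rw [one_div]
  rcases hα.lt_or_gt with h | h
  · rw [Real.rpow_inv_le_iff_of_neg hS hr h, div_le_div_right_of_neg h]
  · rw [Real.rpow_inv_le_iff_of_pos hS.le hr.le h, div_le_div_iff_of_pos_right h]

lemma hasDerivAt_comp_segment {n : ℕ} {V : E n → ℝ} {U : Set (E n)} (hU : IsOpen U)
    (hV : ContDiffOn ℝ 2 V U) {x v : E n} {t : ℝ} (ht : x + t • v ∈ U) :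
    HasDerivAt (fun t : ℝ => V (x + t • v)) (fderiv ℝ V (x + t • v) v) t ∧
    HasDerivAt (fun t : ℝ => fderiv ℝ V (x + t • v) v)
      (fderiv ℝ (fderiv ℝ V) (x + t • v) v v) t := by
  have hl : HasDerivAt (fun t : ℝ => x + t • v) v t := by
    simpa using ((hasDerivAt_id t).smul_const v).const_add x
  have hc : ContDiffAt ℝ 2 V (x + t • v) := hV.contDiffAt (hU.mem_nhds ht)
  refine ⟨(hc.differentiableAt (by norm_num)).hasFDerivAt.comp_hasDerivAt t hl, ?_⟩
  have hd : DifferentiableAt ℝ (fderiv ℝ V) (x + t • v) :=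
    (hc.fderiv_right (m := 1) (by norm_num)).differentiableAt (by norm_num)
  have := hd.hasFDerivAt.comp_hasDerivAt t hl
  exact ((ContinuousLinearMap.apply ℝ ℝ v).hasFDerivAt.comp_hasDerivAt t this)

/-- If `∇²V ≥ α dV ⊗ dV`, then `exp (-V)` is `α`-concave. -/
lemma powMean_exp_neg_le {n : ℕ} {V : E n → ℝ} {U : Set (E n)} (hU : IsOpen U)
    (hUc : Convex ℝ U) (hV : ContDiffOn ℝ 2 V U) {α : ℝ} (hα : α ≠ 0)
    (hH : ∀ x ∈ U, ∀ v : E n, α * (fderiv ℝ V x v) ^ 2 ≤ fderiv ℝ (fderiv ℝ V) x v v)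
    {s : ℝ} (hs : s ∈ Ioo (0 : ℝ) 1) {x y : E n} (hx : x ∈ U) (hy : y ∈ U) :
    powMean s α (Real.exp (-V x)) (Real.exp (-V y)) ≤
      Real.exp (-V ((1 - s) • x + s • y)) := by
  rw [powMean_le_iff hs hα (Real.exp_pos _) (Real.exp_pos _) (Real.exp_pos _)]
  simp only [← Real.exp_mul]
  have hmem : ∀ t ∈ Icc (0 : ℝ) 1, x + t • (y - x) ∈ U :=
    fun t ht => hUc.add_smul_sub_mem hx hy ht
  set W : ℝ → ℝ := fun t => V (x + t • (y - x)) with hW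
  have h1 : ∀ t ∈ Icc (0 : ℝ) 1, HasDerivAt W (fderiv ℝ V (x + t • (y - x)) (y - x)) t :=
    fun t ht => (hasDerivAt_comp_segment hU hV (hmem t ht)).1
  have h2 := fun t ht => (hasDerivAt_comp_segment hU hV (hmem t ht)).2
  have hq : ∀ t ∈ Icc (0 : ℝ) 1, HasDerivAt (fun t => Real.exp (-W t * α) / α)
      (-(fderiv ℝ V (x + t • (y - x)) (y - x)) * Real.exp (-W t * α)) t := by
    intro t ht
    convert! (((h1 t ht).fun_neg.mul_const α).exp.div_const α) using 1
    field_simp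
  have hq2 : ∀ t ∈ Icc (0 : ℝ) 1, HasDerivAt
      (fun t => -(fderiv ℝ V (x + t • (y - x)) (y - x)) * Real.exp (-W t * α))
      ((α * (fderiv ℝ V (x + t • (y - x)) (y - x)) ^ 2 -
        fderiv ℝ (fderiv ℝ V) (x + t • (y - x)) (y - x) (y - x)) * Real.exp (-W t * α)) t := by
    intro t ht
    convert! (h2 t ht).fun_neg.mul (((h1 t ht).fun_neg.mul_const α).exp) using 1
    ring
  have hconc : ConcaveOn ℝ (Icc (0 : ℝ) 1) (fun t => Real.exp (-W t * α) / α) := by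
    refine concaveOn_of_hasDerivWithinAt2_nonpos (convex_Icc 0 1)
      (fun t ht => (hq t ht).continuousAt.continuousWithinAt)
      (fun t ht => (hq t (interior_subset ht)).hasDerivWithinAt)
      (fun t ht => (hq2 t (interior_subset ht)).hasDerivWithinAt) ?_
    intro t ht
    refine mul_nonpos_of_nonpos_of_nonneg ?_ (Real.exp_pos _).le
    have := hH _ (hmem t (interior_subset ht)) (y - x)
    linarith
  have := hconc.2 (left_mem_Icc.2 zero_le_one) (right_mem_Icc.2 zero_le_one)
    (sub_pos.2 hs.2).le hs.1.le (by ring)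
  simp only [smul_eq_mul, mul_zero, mul_one, zero_add, hW, zero_smul, add_zero, one_smul,
    add_sub_cancel] at this
  rwa [show x + s • (y - x) = (1 - s) • x + s • y by module] at this

/-! ### The generalized Brunn–Minkowski inequality under `CD(0, N)` -/

/-- The Hessian condition in `CD(0, N)` is monotone in `κ = 1/N`. In the case `N = n` it holds for
all smaller `κ` because the potential is constant. -/
lemma hessian_bound_of_lt {n : ℕ} (hn : 1 ≤ n) {κ κ' : ℝ} (hκ : κ ≤ 1 / (n : ℝ)) (hlt : κ' < κ)
    {Ω : Set (E n)} {V : E n → ℝ}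
    (hconst : (n : ℝ) * κ = 1 → ∃ c : ℝ, ∀ x ∈ interior Ω, V x = c)
    (hH : ∀ x ∈ interior Ω, ∀ v : E n,
      0 ≤ fderiv ℝ (fderiv ℝ V) x v v - κ / (1 - n * κ) * (fderiv ℝ V x v) ^ 2)
    {x : E n} (hx : x ∈ interior Ω) (v : E n) :
    κ' / (1 - n * κ') * (fderiv ℝ V x v) ^ 2 ≤ fderiv ℝ (fderiv ℝ V) x v v := by
  have hn0 : (0 : ℝ) < n := by exact_mod_cast hn
  have hle : n * κ ≤ 1 := by rw [le_div_iff₀ hn0] at hκ; linarith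
  have h := hH x hx v
  rcases hle.eq_or_lt with he | hl
  · obtain ⟨c, hc⟩ := hconst he
    have hev : V =ᶠ[𝓝 x] fun _ => c :=
      Filter.eventually_of_mem (isOpen_interior.mem_nhds hx) hc
    rw [hev.fderiv_eq] at h ⊢
    simp only [fderiv_fun_const, Pi.zero_apply, zero_apply] at h ⊢
    simpa using h
  · have h1 : 0 < 1 - n * κ := by linarith
    have h2 : 0 < 1 - n * κ' := by nlinarith
    have : κ' / (1 - n * κ') ≤ κ / (1 - n * κ) := by
      rw [div_le_div_iff₀ h2 h1]; nlinarith
    nlinarith [sq_nonneg (fderiv ℝ V x v), mul_le_mul_of_nonneg_right this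
      (sq_nonneg (fderiv ℝ V x v))]

lemma powMean_measure_le {n : ℕ} (hn : 1 ≤ n) {κ κ' : ℝ} (hκ : κ ≤ 1 / (n : ℝ)) (hlt : κ' < κ)
    (hκ0 : κ' ≠ 0) {Ω : Set (E n)} (hΩ : Convex ℝ Ω) {μ : Measure (E n)}
    (hCD : SatisfiesCDZero κ Ω μ) {s : ℝ} (hs : s ∈ Ioo (0 : ℝ) 1) {A B C : Set (E n)}
    (hA : MeasurableSet A) (hB : MeasurableSet B) (hC : MeasurableSet C)
    (hABC : ∀ x ∈ A, ∀ y ∈ B, (1 - s) • x + s • y ∈ C) {a b : ℝ} (ha : 0 < a) (hb : 0 < b)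
    (haA : ENNReal.ofReal a < μ A) (hbB : ENNReal.ofReal b < μ B) :
    ENNReal.ofReal (powMean s κ' a b) ≤ μ C := by
  obtain ⟨V, hV, hμ, hconst, hH⟩ := hCD
  have hn0 : (0 : ℝ) < n := by exact_mod_cast hn
  have hle : n * κ ≤ 1 := by rw [le_div_iff₀ hn0] at hκ; linarith
  have h2 : 0 < 1 - n * κ' := by nlinarith
  set α := κ' / (1 - n * κ') with hα
  have hα0 : α ≠ 0 := div_ne_zero hκ0 h2.ne'
  have hα1 : 1 + n * α = 1 / (1 - n * κ') := by
    rw [eq_div_iff h2.ne', add_mul, mul_assoc, hα, div_mul_cancel₀ _ h2.ne']; ring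
  have hακ : α / (1 + n * α) = κ' := by
    rw [hα1, hα, div_div, mul_one_div_cancel h2.ne', div_one]
  set U := interior Ω with hU
  set p : E n → ℝ≥0∞ := fun x => ENNReal.ofReal (Real.exp (-V x)) with hp
  have hpm : ∀ {A : Set (E n)}, MeasurableSet A → Measurable ((A ∩ U).indicator p) := by
    intro A hA
    have hU' : MeasurableSet U := isOpen_interior.measurableSet
    have : Measurable (U.indicator p) := by
      classical
      rw [← piecewise_eq_indicator]
      have hc : ContinuousOn p U :=
        ENNReal.continuous_ofReal.comp_continuousOn
          (Real.continuous_exp.comp_continuousOn hV.continuousOn.neg)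
      exact hc.measurable_piecewise continuousOn_const hU'
    rw [← indicator_indicator]
    exact this.indicator hA
  have hμA : ∀ {A : Set (E n)}, MeasurableSet A → μ A = ∫⁻ x, (A ∩ U).indicator p x := by
    intro A hA
    rw [hμ, withDensity_apply _ hA, Measure.restrict_restrict hA,
      lintegral_indicator (hA.inter isOpen_interior.measurableSet)]
  rw [hμA hA] at haA
  rw [hμA hB] at hbB
  rw [hμA hC, ← hακ]
  refine borell_brascamp_lieb_euclidean hs hα0 (by rw [hα1]; positivity) (hpm hA) (hpm hB)
    (hpm hC) ?_ ha hb haA hbB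
  intro x y a b ha hb hax hby
  have hxm : x ∈ A ∩ U := by
    by_contra h
    rw [indicator_of_notMem h] at hax
    exact not_lt_zero hax
  have hym : y ∈ B ∩ U := by
    by_contra h
    rw [indicator_of_notMem h] at hby
    exact not_lt_zero hby
  have hzm : (1 - s) • x + s • y ∈ C ∩ U :=
    ⟨hABC x hxm.1 y hym.1, hΩ.interior hxm.2 hym.2 (sub_pos.2 hs.2).le hs.1.le (by ring)⟩
  rw [indicator_of_mem hxm, hp] at hax
  rw [indicator_of_mem hym, hp] at hby
  rw [indicator_of_mem hzm]
  refine ENNReal.ofReal_le_ofReal ((powMean_mono hs ha hb ?_ ?_).trans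
    (powMean_exp_neg_le isOpen_interior hΩ.interior hV hα0
      (fun x hx v => hessian_bound_of_lt hn hκ hlt hconst hH hx v) hs hxm.2 hym.2))
  · exact ((ENNReal.ofReal_lt_ofReal_iff (Real.exp_pos _)).1 hax).le
  · exact ((ENNReal.ofReal_lt_ofReal_iff (Real.exp_pos _)).1 hby).le

/-- `(x ^ k - 1) / k` tends to `N x^{1/N}`, up to an additive constant independent of `x`, as `k`
increases to `κ = 1/N`. -/
lemma tendsto_rpow_sub_one_div {κ x : ℝ} (hx : 0 < x) :
    Tendsto (fun k : ℝ => (x ^ k - 1) / k) (𝓝[<] κ)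
      (𝓝 (nPow κ x - if κ = 0 then 0 else 1 / κ)) := by
  unfold nPow
  split_ifs with h
  · subst h
    have hd : HasDerivAt (fun k : ℝ => x ^ k) (Real.log x) 0 := by
      simpa using (Real.hasStrictDerivAt_const_rpow hx 0).hasDerivAt
    have := hd.tendsto_slope_zero
    refine ((this.mono_left (nhdsWithin_mono _ fun y hy => ne_of_lt hy)).congr fun k => ?_).trans
      (by simp)
    simp [div_eq_inv_mul]
  · have : ContinuousAt (fun k : ℝ => (x ^ k - 1) / k) κ :=
      ((Real.continuousAt_const_rpow hx.ne').sub continuousAt_const).div continuousAt_id h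
    rw [← sub_div]
    exact this.tendsto.mono_left nhdsWithin_le_nhds

/-- The generalized Brunn–Minkowski inequality. It is obtained for `k < 1/N`, `k ≠ 0`, from the
Borell–Brascamp–Lieb inequality; in the limit `k → 1/N` it covers `N = n` and `N = ∞`, where the
power means degenerate. -/
theorem brunn_minkowski {n : ℕ} (hn : 1 ≤ n) {κ : ℝ} (hκ : κ ≤ 1 / (n : ℝ)) {Ω : Set (E n)}
    (hΩ : Convex ℝ Ω) {μ : Measure (E n)} (hCD : SatisfiesCDZero κ Ω μ) {s : ℝ}
    (hs : s ∈ Ioo (0 : ℝ) 1) {A B C : Set (E n)} (hA : MeasurableSet A) (hB : MeasurableSet B)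
    (hC : MeasurableSet C) (hABC : ∀ x ∈ A, ∀ y ∈ B, (1 - s) • x + s • y ∈ C)
    (hA0 : 0 < μ A) (hB0 : 0 < μ B) (hAf : μ A ≠ ∞) (hBf : μ B ≠ ∞) (hCf : μ C ≠ ∞) :
    0 < μ C ∧ (1 - s) * nPow κ (μ.real A) + s * nPow κ (μ.real B) ≤ nPow κ (μ.real C) := by
  have ha : 0 < μ.real A := ENNReal.toReal_pos hA0.ne' hAf
  have hb : 0 < μ.real B := ENNReal.toReal_pos hB0.ne' hBf
  have key : ∀ k < κ, k ≠ 0 → powMean s k (μ.real A) (μ.real B) ≤ μ.real C := by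
    intro k hk hk0
    have h1 : ∀ c ∈ Ioo (0 : ℝ) 1, c * powMean s k (μ.real A) (μ.real B) ≤ μ.real C := by
      intro c hc
      rw [← powMean_smul hk0 hs hc.1 ha hb]
      have := powMean_measure_le hn hκ hk hk0 hΩ hCD hs hA hB hC hABC (mul_pos hc.1 ha)
        (mul_pos hc.1 hb)
        ((ENNReal.ofReal_lt_iff_lt_toReal (mul_pos hc.1 ha).le hAf).2
          (mul_lt_of_lt_one_left ha hc.2))
        ((ENNReal.ofReal_lt_iff_lt_toReal (mul_pos hc.1 hb).le hBf).2
          (mul_lt_of_lt_one_left hb hc.2))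
      exact (ENNReal.ofReal_le_iff_le_toReal hCf).1 this
    have h2 : Tendsto (fun c : ℝ => c * powMean s k (μ.real A) (μ.real B)) (𝓝[<] 1)
        (𝓝 (1 * powMean s k (μ.real A) (μ.real B))) :=
      (tendsto_id.mul_const _).mono_left nhdsWithin_le_nhds
    rw [one_mul] at h2
    exact le_of_tendsto h2 (Filter.eventually_of_mem (Ioo_mem_nhdsLT zero_lt_one) h1)
  have hev : ∀ᶠ k in 𝓝[<] κ, k < κ ∧ k ≠ 0 := by
    refine Filter.Eventually.and self_mem_nhdsWithin ?_
    by_cases h : κ = 0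
    · exact Filter.eventually_of_mem self_mem_nhdsWithin fun k (hk : k < κ) => by
        rw [h] at hk; exact hk.ne
    · exact nhdsWithin_le_nhds (eventually_ne_nhds h)
  have hc : 0 < μ.real C := by
    obtain ⟨k, hk, hk0⟩ := hev.exists
    exact (powMean_pos hs ha hb).trans_le (key k hk hk0)
  refine ⟨(ENNReal.toReal_pos_iff.1 hc).1, ?_⟩
  have hlim := le_of_tendsto_of_tendsto
    (((tendsto_rpow_sub_one_div (κ := κ) ha).const_mul (1 - s)).add
      ((tendsto_rpow_sub_one_div (κ := κ) hb).const_mul s))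
    (tendsto_rpow_sub_one_div (κ := κ) hc) (hev.mono fun k hk => by
      have := (powMean_le_iff hs hk.2 ha hb hc).1 (key k hk.1 hk.2)
      simp only [sub_div]
      linarith)
  linarith

/-- The Brunn–Minkowski property of order `κ = 1/N` of a measure, for compact sets of positive
measure. -/
def HasBrunnMinkowski {n : ℕ} (κ : ℝ) (μ : Measure (E n)) : Prop :=
  ∀ s ∈ Ioo (0 : ℝ) 1, ∀ A B C : Set (E n), IsCompact A → IsCompact B → IsCompact C →
    (∀ x ∈ A, ∀ y ∈ B, (1 - s) • x + s • y ∈ C) → 0 < μ A → 0 < μ B →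
    0 < μ C ∧ (1 - s) * nPow κ (μ.real A) + s * nPow κ (μ.real B) ≤ nPow κ (μ.real C)

lemma SatisfiesCDZero.hasBrunnMinkowski {n : ℕ} (hn : 1 ≤ n) {κ : ℝ} (hκ : κ ≤ 1 / (n : ℝ))
    {Ω : Set (E n)} (hΩ : Convex ℝ Ω) {μ : Measure (E n)} [IsLocallyFiniteMeasure μ]
    (hCD : SatisfiesCDZero κ Ω μ) : HasBrunnMinkowski κ μ :=
  fun _ hs _ _ _ hA hB hC hABC hA0 hB0 => brunn_minkowski hn hκ hΩ hCD hs hA.measurableSet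
    hB.measurableSet hC.measurableSet hABC hA0 hB0 hA.measure_ne_top hB.measure_ne_top
    hC.measure_ne_top

/-! ### The function `N x^{1/N}` -/

lemma hasDerivAt_nPow (κ : ℝ) {x : ℝ} (hx : 0 < x) : HasDerivAt (nPow κ) (x ^ (κ - 1)) x := by
  unfold nPow
  by_cases h : κ = 0
  · simp only [h, if_true, zero_sub, Real.rpow_neg_one]
    exact Real.hasDerivAt_log hx.ne'
  · simp only [h, if_false]
    convert! (Real.hasDerivAt_rpow_const (p := κ) (Or.inl hx.ne')).div_const κ using 1
    field_simp

lemma nPow_le_nPow (κ : ℝ) {a b : ℝ} (ha : 0 < a) (hab : a ≤ b) : nPow κ a ≤ nPow κ b := by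
  unfold nPow
  split_ifs with h
  · exact Real.log_le_log ha hab
  · rcases lt_or_gt_of_ne h with h | h
    · exact (div_le_div_right_of_neg h).2 (Real.rpow_le_rpow_of_nonpos ha hab h.le)
    · exact (div_le_div_iff_of_pos_right h).2 (Real.rpow_le_rpow ha.le hab h.le)

/-! ### Enlargements `K + tL` -/

/-- The properties of `K` and `L` on which the evolution of `μ (K + t • L)` depends. -/
structure IsGrowthPair {n : ℕ} (μ : Measure (E n)) (L K : Set (E n)) : Prop where
  isCompact : IsCompact K
  convex : Convex ℝ K
  measure_pos : 0 < μ K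
  isCompact' : IsCompact L
  convex' : Convex ℝ L
  zero_mem : (0 : E n) ∈ L

section Enlargement

variable {n : ℕ} {κ : ℝ} {μ : Measure (E n)} {K L : Set (E n)}

lemma mix_mem_enlargement (hK : Convex ℝ K) (hL : Convex ℝ L) {s t t' : ℝ}
    (hs : s ∈ Ioo (0 : ℝ) 1) (ht : 0 ≤ t) (ht' : 0 ≤ t') {x y : E n} (hx : x ∈ K + t • L)
    (hy : y ∈ K + t' • L) : (1 - s) • x + s • y ∈ K + ((1 - s) * t + s * t') • L := by
  have hs1 := (sub_pos.2 hs.2).le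
  obtain ⟨k, hk, _, ⟨l, hl, rfl⟩, rfl⟩ := hx
  obtain ⟨k', hk', _, ⟨l', hl', rfl⟩, rfl⟩ := hy
  rw [hL.add_smul (mul_nonneg hs1 ht) (mul_nonneg hs.1.le ht')]
  refine ⟨(1 - s) • k + s • k', hK hk hk' hs1 hs.1.le (by ring), _,
    ⟨_, ⟨l, hl, rfl⟩, _, ⟨l', hl', rfl⟩, rfl⟩, ?_⟩
  simp only
  module

lemma isCompact_enlargement (hK : IsCompact K) (hL : IsCompact L) (t : ℝ) :
    IsCompact (K + t • L) :=
  hK.add (hL.smul t)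

lemma enlargement_zero (hL : L.Nonempty) : K + (0 : ℝ) • L = K := by
  rw [zero_smul_set hL, add_zero]

lemma subset_enlargement (hL0 : (0 : E n) ∈ L) (t : ℝ) : K ⊆ K + t • L :=
  fun x hx => ⟨x, hx, 0, ⟨0, hL0, smul_zero t⟩, add_zero x⟩

lemma enlargement_mono (hL : Convex ℝ L) (hL0 : (0 : E n) ∈ L) {t t' : ℝ} (ht : 0 ≤ t)
    (htt : t ≤ t') : K + t • L ⊆ K + t' • L := by
  refine add_subset_add_left ?_
  rw [← sub_add_cancel t' t, hL.add_smul (sub_nonneg.2 htt) ht]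
  exact fun x hx => ⟨0, ⟨0, hL0, smul_zero _⟩, x, hx, zero_add x⟩

lemma exists_forall_subset_smul (hK : IsCompact K) (hL0 : (0 : E n) ∈ interior L) :
    ∃ c : ℝ, 0 < c ∧ ∀ t ≥ c, K ⊆ t • L := by
  obtain ⟨r, hr, hrL⟩ := Metric.mem_nhds_iff.1 (mem_interior_iff_mem_nhds.1 hL0)
  obtain ⟨R, hR, hKR⟩ := hK.isBounded.subset_closedBall_lt 0 0
  refine ⟨2 * R / r, by positivity, fun t ht x hx => ?_⟩
  have ht0 : 0 < t := lt_of_lt_of_le (by positivity) ht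
  refine ⟨t⁻¹ • x, hrL ?_, smul_inv_smul₀ ht0.ne' x⟩
  have hx' : ‖x‖ ≤ R := by simpa using hKR hx
  rw [mem_ball_zero_iff, norm_smul, norm_inv, Real.norm_of_nonneg ht0.le, inv_mul_lt_iff₀ ht0]
  have : 2 * R ≤ t * r := (div_le_iff₀ hr).1 ht
  linarith

/-- Concavity of `t ↦ N μ(K + tL)^{1/N}`. -/
lemma concaveOn_nPow_enlargement (hBM : HasBrunnMinkowski κ μ) (hK : IsCompact K)
    (hKc : Convex ℝ K) (hL : IsCompact L) (hLc : Convex ℝ L) :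
    ConcaveOn ℝ {t : ℝ | 0 ≤ t ∧ 0 < μ (K + t • L)}
      (fun t : ℝ => nPow κ (μ.real (K + t • L))) := by
  have key : ∀ t ∈ {t : ℝ | 0 ≤ t ∧ 0 < μ (K + t • L)},
      ∀ t' ∈ {t : ℝ | 0 ≤ t ∧ 0 < μ (K + t • L)}, ∀ s ∈ Ioo (0 : ℝ) 1,
      0 < μ (K + ((1 - s) * t + s * t') • L) ∧
        (1 - s) * nPow κ (μ.real (K + t • L)) + s * nPow κ (μ.real (K + t' • L)) ≤
          nPow κ (μ.real (K + ((1 - s) * t + s * t') • L)) := by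
    intro t ht t' ht' s hs
    exact hBM s hs _ _ _ (isCompact_enlargement hK hL t) (isCompact_enlargement hK hL t')
      (isCompact_enlargement hK hL _)
      (fun x hx y hy => mix_mem_enlargement hKc hLc hs ht.1 ht'.1 hx hy) ht.2 ht'.2
  have hcases : ∀ a b : ℝ, 0 ≤ a → 0 ≤ b → a + b = 1 →
      (a = 1 ∧ b = 0) ∨ (a = 0 ∧ b = 1) ∨ (a = 1 - b ∧ b ∈ Ioo (0 : ℝ) 1) := by
    intro a b ha hb hab
    rcases hb.eq_or_lt with h | h
    · left; constructor <;> linarith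
    rcases ha.eq_or_lt with h' | h'
    · right; left; constructor <;> linarith
    · right; right; exact ⟨by linarith, h, by linarith⟩
  refine ⟨fun t ht t' ht' a b ha hb hab => ?_, fun t ht t' ht' a b ha hb hab => ?_⟩
  · rcases hcases a b ha hb hab with ⟨rfl, rfl⟩ | ⟨rfl, rfl⟩ | ⟨rfl, h⟩
    · simpa using ht
    · simpa using ht'
    · have h1 := ht.1
      have h2 := ht'.1
      exact ⟨by simp only [smul_eq_mul]; positivity, (key t ht t' ht' b h).1⟩
  · rcases hcases a b ha hb hab with ⟨rfl, rfl⟩ | ⟨rfl, rfl⟩ | ⟨rfl, h⟩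
    · simp
    · simp
    · exact (key t ht t' ht' b h).2

lemma IsGrowthPair.nonempty (h : IsGrowthPair μ L K) : K.Nonempty :=
  nonempty_of_measure_ne_zero h.measure_pos.ne'

lemma IsGrowthPair.enlargement_pos (h : IsGrowthPair μ L K) (t : ℝ) : 0 < μ (K + t • L) :=
  h.measure_pos.trans_le (measure_mono (subset_enlargement h.zero_mem t))

lemma IsGrowthPair.concaveOn (hBM : HasBrunnMinkowski κ μ) (h : IsGrowthPair μ L K) :
    ConcaveOn ℝ (Ici (0 : ℝ)) (fun t : ℝ => nPow κ (μ.real (K + t • L))) := by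
  have := concaveOn_nPow_enlargement hBM h.isCompact h.convex h.isCompact' h.convex'
  rwa [show {t : ℝ | 0 ≤ t ∧ 0 < μ (K + t • L)} = Ici 0 from
    Set.ext fun t => ⟨fun ht => ht.1, fun ht => ⟨ht, h.enlargement_pos t⟩⟩] at this

variable [IsLocallyFiniteMeasure μ]

lemma IsGrowthPair.real_enlargement_pos (h : IsGrowthPair μ L K) (t : ℝ) :
    0 < μ.real (K + t • L) :=
  ENNReal.toReal_pos (h.enlargement_pos t).ne'
    (isCompact_enlargement h.isCompact h.isCompact' t).measure_ne_top

lemma IsGrowthPair.real_pos (h : IsGrowthPair μ L K) : 0 < μ.real K :=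
  ENNReal.toReal_pos h.measure_pos.ne' h.isCompact.measure_ne_top

/-- `μ (K + t • L)` is right-continuous at `t = 0`: the enlargements lie in the closed
`R t`-neighbourhoods of the compact set `K`. -/
lemma IsGrowthPair.tendsto_real_enlargement (h : IsGrowthPair μ L K) :
    Tendsto (fun t : ℝ => μ.real (K + t • L)) (𝓝[>] 0) (𝓝 (μ.real K)) := by
  refine (ENNReal.tendsto_toReal h.isCompact.measure_ne_top).comp ?_
  obtain ⟨R, hR, hLR⟩ := h.isCompact'.isBounded.subset_closedBall_lt 0 0
  have h1 : Tendsto (fun t : ℝ => μ (Metric.cthickening (t * R) K)) (𝓝[>] 0) (𝓝 (μ K)) := by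
    refine (tendsto_measure_cthickening_of_isCompact h.isCompact).comp ?_
    have : Tendsto (fun t : ℝ => t * R) (𝓝 0) (𝓝 (0 * R)) := tendsto_id.mul_const R
    rw [zero_mul] at this
    exact this.mono_left nhdsWithin_le_nhds
  refine tendsto_of_tendsto_of_tendsto_of_le_of_le' tendsto_const_nhds h1
    (Eventually.of_forall fun t => measure_mono (subset_enlargement h.zero_mem t)) ?_
  filter_upwards [self_mem_nhdsWithin] with t (ht : 0 < t)
  refine measure_mono ?_
  rintro _ ⟨k, hk, _, ⟨l, hl, rfl⟩, rfl⟩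
  refine Metric.mem_cthickening_of_dist_le _ k _ _ hk ?_
  have : ‖l‖ ≤ R := by simpa using hLR hl
  rw [dist_eq_norm, add_sub_cancel_left, norm_smul, Real.norm_of_nonneg ht.le]
  gcongr

end Enlargement

/-! ### The boundary measure as a one-sided derivative -/

/-- The right derivative at `0` of a function `m` such that `N m^{1/N}` is concave: the difference
quotients of `N m^{1/N}` increase as `t` decreases to `0`, and the chain rule converts them. -/
lemma tendsto_ofReal_slope {κ : ℝ} {m : ℝ → ℝ} (hm0 : 0 < m 0)
    (hm : Tendsto m (𝓝[>] 0) (𝓝 (m 0)))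
    (hc : ConcaveOn ℝ (Ici (0 : ℝ)) (fun t => nPow κ (m t))) :
    Tendsto (fun t => ENNReal.ofReal ((m t - m 0) / t)) (𝓝[>] 0)
      (𝓝 (ENNReal.ofReal (m 0 ^ (1 - κ)) *
        ⨆ t ∈ Ioi (0 : ℝ), ENNReal.ofReal ((nPow κ (m t) - nPow κ (m 0)) / t))) := by
  set σ : ℝ → ℝ≥0∞ := fun t => ENNReal.ofReal ((nPow κ (m t) - nPow κ (m 0)) / t) with hσ
  have hanti : ∀ t t' : ℝ, 0 < t → t ≤ t' → σ t' ≤ σ t := by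
    intro t t' ht htt
    refine ENNReal.ofReal_le_ofReal ?_
    have := hc.slope_anti (mem_Ici.2 le_rfl) (x := 0) (a := t) (b := t') ⟨ht.le, ht.ne'⟩
      ⟨(ht.trans_le htt).le, (ht.trans_le htt).ne'⟩ htt
    simpa [slope_def_field] using this
  have hσlim : Tendsto σ (𝓝[>] 0) (𝓝 (⨆ t ∈ Ioi (0 : ℝ), σ t)) := by
    refine tendsto_order.2 ⟨fun b hb => ?_, fun b hb => ?_⟩
    · obtain ⟨t, ht⟩ := lt_iSup_iff.1 hb
      obtain ⟨ht0, ht⟩ := lt_iSup_iff.1 ht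
      filter_upwards [Ioo_mem_nhdsGT ht0] with u hu
      exact ht.trans_le (hanti u t hu.1 hu.2.le)
    · filter_upwards [self_mem_nhdsWithin] with u hu
      exact (le_iSup₂ (f := fun t (_ : t ∈ Ioi (0 : ℝ)) => σ t) u hu).trans_lt hb
  set d : ℝ → ℝ := fun t => dslope (nPow κ) (m 0) (m t) with hd
  have hder := hasDerivAt_nPow κ hm0
  have hdlim : Tendsto d (𝓝[>] 0) (𝓝 (m 0 ^ (κ - 1))) := by
    have := (continuousAt_dslope_same.2 hder.differentiableAt).tendsto
    rw [dslope_same, hder.deriv] at this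
    exact this.comp hm
  have hpos : 0 < m 0 ^ (κ - 1) := Real.rpow_pos_of_pos hm0 _
  have hinv : Tendsto (fun t => ENNReal.ofReal (d t)⁻¹) (𝓝[>] 0)
      (𝓝 (ENNReal.ofReal (m 0 ^ (1 - κ)))) := by
    have := ENNReal.tendsto_ofReal (hdlim.inv₀ hpos.ne')
    rwa [← Real.rpow_neg hm0.le, neg_sub] at this
  have hpos' : 0 < m 0 ^ (1 - κ) := Real.rpow_pos_of_pos hm0 _
  have hmul := ENNReal.Tendsto.mul hinv (Or.inl (by simpa using hpos')) hσlim
    (Or.inr ENNReal.ofReal_ne_top)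
  refine hmul.congr' ?_
  filter_upwards [hdlim.eventually (lt_mem_nhds hpos)] with t ht
  rw [hσ, ← ENNReal.ofReal_mul (inv_pos.2 ht).le]
  have : (m t - m 0) * d t = nPow κ (m t) - nPow κ (m 0) := by
    rw [hd]
    simpa using sub_smul_dslope (nPow κ) (m 0) (m t)
  rw [← this]
  congr 1
  field_simp

section BoundaryMeasure

variable {n : ℕ} {κ : ℝ} {μ : Measure (E n)} {K L : Set (E n)}

lemma coe_slope_le {t : ℝ} (ht : 0 < t) :
    (((nPow κ (μ.real (K + t • L)) - nPow κ (μ.real K)) / t : ℝ) : EReal) ≤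
      ((⨆ t ∈ Ioi (0 : ℝ),
        ENNReal.ofReal ((nPow κ (μ.real (K + t • L)) - nPow κ (μ.real K)) / t) : ℝ≥0∞) : EReal) :=
  calc _ ≤ ((ENNReal.ofReal ((nPow κ (μ.real (K + t • L)) - nPow κ (μ.real K)) / t) : ℝ≥0∞) :
        EReal) := by
        rw [EReal.coe_ennreal_ofReal]; exact EReal.coe_le_coe_iff.2 (le_max_left _ _)
    _ ≤ _ := EReal.coe_ennreal_le_coe_ennreal_iff.2 (le_iSup₂ (f := fun t (_ : t ∈ Ioi (0 : ℝ)) =>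
        ENNReal.ofReal ((nPow κ (μ.real (K + t • L)) - nPow κ (μ.real K)) / t)) t ht)

variable [IsLocallyFiniteMeasure μ]

lemma tendsto_boundary_quotient (hBM : HasBrunnMinkowski κ μ) (h : IsGrowthPair μ L K) :
    Tendsto (fun t : ℝ => (μ (K + t • L) - μ K) / ENNReal.ofReal t) (𝓝[>] 0)
      (𝓝 (ENNReal.ofReal (μ.real K ^ (1 - κ)) * ⨆ t ∈ Ioi (0 : ℝ),
        ENNReal.ofReal ((nPow κ (μ.real (K + t • L)) - nPow κ (μ.real K)) / t))) := by
  have h0 : K + (0 : ℝ) • L = K := enlargement_zero ⟨0, h.zero_mem⟩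
  have := tendsto_ofReal_slope (κ := κ) (m := fun t => μ.real (K + t • L))
    (h.real_enlargement_pos 0) (by simpa only [h0] using h.tendsto_real_enlargement)
    (h.concaveOn hBM)
  simp only [h0] at this
  refine this.congr' ?_
  filter_upwards [self_mem_nhdsWithin] with t (ht : 0 < t)
  rw [ENNReal.ofReal_div_of_pos ht, ENNReal.ofReal_sub _ measureReal_nonneg,
    ofReal_measureReal (isCompact_enlargement h.isCompact h.isCompact' t).measure_ne_top,
    ofReal_measureReal h.isCompact.measure_ne_top]

/-- The boundary measure in terms of the difference quotients of `N μ(K + tL)^{1/N}`. -/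
lemma boundaryMeasure_eq (hBM : HasBrunnMinkowski κ μ) (h : IsGrowthPair μ L K) :
    boundaryMeasure μ L K = ENNReal.ofReal (μ.real K ^ (1 - κ)) * ⨆ t ∈ Ioi (0 : ℝ),
      ENNReal.ofReal ((nPow κ (μ.real (K + t • L)) - nPow κ (μ.real K)) / t) :=
  (tendsto_boundary_quotient hBM h).liminf_eq

/-! ### The isoperimetric inequalities -/

lemma le_boundaryMeasure_of_le (hBM : HasBrunnMinkowski κ μ) (h : IsGrowthPair μ L K) {c : EReal}
    (hc : c ≤ ((⨆ t ∈ Ioi (0 : ℝ),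
      ENNReal.ofReal ((nPow κ (μ.real (K + t • L)) - nPow κ (μ.real K)) / t) : ℝ≥0∞) : EReal)) :
    ((μ.real K ^ (1 - κ) : ℝ) : EReal) * c ≤ (boundaryMeasure μ L K : EReal) := by
  have hp : 0 ≤ μ.real K ^ (1 - κ) := Real.rpow_nonneg h.real_pos.le _
  rw [boundaryMeasure_eq hBM h, EReal.coe_ennreal_mul, EReal.coe_ennreal_ofReal, max_eq_left hp]
  exact mul_le_mul_of_nonneg_left hc (EReal.coe_nonneg.2 hp)

lemma le_boundaryMeasure_of_diameter (hBM : HasBrunnMinkowski κ μ) (h : IsGrowthPair μ L K)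
    {D : ℝ} (hD : 0 < D) (hKΩ : K ⊆ μ.support) (hΩD : μ.support - μ.support ⊆ D • L) :
    ((1 / D * μ.real K ^ (1 - κ) * (nPow κ (μ.real μ.support) - nPow κ (μ.real K)) : ℝ) : EReal)
      ≤ (boundaryMeasure μ L K : EReal) := by
  obtain ⟨k, hk⟩ := h.nonempty
  have hsub : μ.support ⊆ K + D • L := fun x hx =>
    ⟨k, hk, x - k, hΩD ⟨x, hx, k, hKΩ hk, rfl⟩, add_sub_cancel k x⟩
  have e : μ.real (K + D • L) = μ.real μ.support := by
    have hm : μ (K + D • L) = μ μ.support :=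
      le_antisymm (measure_mono_ae (by
        filter_upwards [μ.support_mem_ae] with x hx _ using hx)) (measure_mono hsub)
    rw [measureReal_def, hm, measureReal_def]
  have := le_boundaryMeasure_of_le hBM h (coe_slope_le (κ := κ) (μ := μ) (K := K) (L := L) hD)
  rw [e, ← EReal.coe_mul] at this
  convert! this using 2
  field_simp

/-- The growth of `N μ(tL)^{1/N}` at infinity bounds the boundary measure from below, because
`tL ⊆ K + (t + c)L` for some `c`. -/
lemma limsup_le_boundaryMeasure (hBM : HasBrunnMinkowski κ μ) (h : IsGrowthPair μ L K)
    (hL0 : (0 : E n) ∈ interior L) :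
    ((μ.real K ^ (1 - κ) : ℝ) : EReal) *
        limsup (fun t : ℝ => ((nPow κ (μ.real (t • L)) / t : ℝ) : EReal)) atTop
      ≤ (boundaryMeasure μ L K : EReal) := by
  apply le_boundaryMeasure_of_le hBM h
  set S : ℝ≥0∞ := ⨆ t ∈ Ioi (0 : ℝ),
    ENNReal.ofReal ((nPow κ (μ.real (K + t • L)) - nPow κ (μ.real K)) / t) with hS
  by_cases hSt : S = ∞
  · rw [hSt, EReal.coe_ennreal_top]; exact le_top
  obtain ⟨c₁, hc₁, hKL⟩ := exists_forall_subset_smul h.isCompact hL0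
  obtain ⟨k, hk⟩ := h.nonempty
  obtain ⟨c, hc, hkc⟩ := exists_forall_subset_smul (K := {-k}) isCompact_singleton hL0
  set σ := S.toReal with hσ
  have hslope : ∀ t : ℝ, 0 < t →
      nPow κ (μ.real (K + t • L)) ≤ nPow κ (μ.real K) + σ * t := by
    intro t ht
    have := le_iSup₂ (f := fun t (_ : t ∈ Ioi (0 : ℝ)) =>
        ENNReal.ofReal ((nPow κ (μ.real (K + t • L)) - nPow κ (μ.real K)) / t)) t ht
    rw [← hS, ENNReal.ofReal_le_iff_le_toReal hSt, div_le_iff₀ ht] at this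
    linarith
  have hle : ∀ᶠ t : ℝ in atTop, ((nPow κ (μ.real (t • L)) / t : ℝ) : EReal) ≤
      (((nPow κ (μ.real K) + σ * c) * t⁻¹ + σ : ℝ) : EReal) := by
    filter_upwards [eventually_ge_atTop c₁] with t ht
    have ht0 : 0 < t := hc₁.trans_le ht
    have hsub : t • L ⊆ K + (t + c) • L := by
      rw [h.convex'.add_smul ht0.le hc.le]
      intro x hx
      exact ⟨k, hk, x + -k, ⟨x, hx, -k, hkc c le_rfl rfl, rfl⟩, by simp⟩
    have hfin : μ (K + (t + c) • L) ≠ ∞ :=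
      (isCompact_enlargement h.isCompact h.isCompact' _).measure_ne_top
    have h1 : μ.real (t • L) ≤ μ.real (K + (t + c) • L) := measureReal_mono hsub hfin
    have h2 : 0 < μ.real (t • L) :=
      h.real_pos.trans_le (measureReal_mono (hKL t ht) (h.isCompact'.smul t).measure_ne_top)
    have h3 := (nPow_le_nPow κ h2 h1).trans (hslope (t + c) (by positivity))
    refine EReal.coe_le_coe_iff.2 ?_
    rw [div_le_iff₀ ht0]
    refine h3.trans (le_of_eq ?_)
    field_simp
    ring
  have hlim : Tendsto (fun t : ℝ => (((nPow κ (μ.real K) + σ * c) * t⁻¹ + σ : ℝ) : EReal)) atTop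
      (𝓝 ((σ : ℝ) : EReal)) := by
    refine (continuous_coe_real_ereal.tendsto _).comp ?_
    simpa using (tendsto_inv_atTop_zero.const_mul (nPow κ (μ.real K) + σ * c)).add_const σ
  calc _ ≤ limsup (fun t : ℝ => (((nPow κ (μ.real K) + σ * c) * t⁻¹ + σ : ℝ) : EReal)) atTop :=
        limsup_le_limsup hle
    _ = ((σ : ℝ) : EReal) := hlim.limsup_eq
    _ = (S : EReal) := EReal.coe_ennreal_toReal hSt

end BoundaryMeasure

/-! ### Smooth strictly convex exhaustions -/

/-- A `C²` convex function on `ℝⁿ` with positive definite Hessian and compact sublevel sets. -/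
structure IsConvexExhaustion {n : ℕ} (f : E n → ℝ) : Prop where
  contDiff : ContDiff ℝ 2 f
  convexOn : ConvexOn ℝ univ f
  isCompact (c : ℝ) : IsCompact {x | f x ≤ c}
  hessian_pos (x v : E n) : v ≠ 0 → 0 < fderiv ℝ (fderiv ℝ f) x v v

/-- The convex function `∑ exp(ℓᵢ - bᵢ) + ε |x|²`, a smooth replacement for `max (ℓᵢ - bᵢ)`.
The affine functions are indexed by the points that they separate from a given set. -/
noncomputable def expSum {n : ℕ} (T : Finset (E n)) (ℓ : E n → E n →L[ℝ] ℝ) (b : E n → ℝ) (ε : ℝ)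
    (x : E n) : ℝ :=
  ∑ i ∈ T, Real.exp (ℓ i x - b i) + ε * ‖x‖ ^ 2

lemma isConvexExhaustion_expSum {n : ℕ} (T : Finset (E n)) (ℓ : E n → E n →L[ℝ] ℝ) (b : E n → ℝ)
    {ε : ℝ} (hε : 0 < ε) : IsConvexExhaustion (expSum T ℓ b ε) := by
  have hcd : ContDiff ℝ 2 (expSum T ℓ b ε) := by
    unfold expSum
    refine ContDiff.add (ContDiff.sum fun i _ => ?_) (contDiff_const.mul (contDiff_norm_sq ℝ))
    exact ((ℓ i).contDiff.sub contDiff_const).exp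
  have hfd : ∀ x v : E n, fderiv ℝ (expSum T ℓ b ε) x v =
      ∑ i ∈ T, Real.exp (ℓ i x - b i) * ℓ i v + ε * (2 * inner ℝ x v) := by
    intro x v
    have h1 : HasFDerivAt (expSum T ℓ b ε)
        (∑ i ∈ T, Real.exp (ℓ i x - b i) • ℓ i + ε • (2 • innerSL ℝ x)) x := by
      unfold expSum
      refine HasFDerivAt.add (HasFDerivAt.fun_sum fun i _ => ?_)
        ((hasStrictFDerivAt_norm_sq x).hasFDerivAt.const_mul ε)
      exact ((ℓ i).hasFDerivAt.sub_const (b i)).exp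
    rw [h1.fderiv]
    simp
  refine ⟨hcd, ?_, fun c => ?_, fun x v hv => ?_⟩
  · refine ConvexOn.add ?_ ?_
    · have : ∀ i ∈ T, ConvexOn ℝ univ (fun x => Real.exp (ℓ i x - b i)) := by
        intro i _
        refine ⟨convex_univ, fun x _ y _ p q hp hq hpq => ?_⟩
        have := convexOn_exp.2 (mem_univ (ℓ i x - b i)) (mem_univ (ℓ i y - b i)) hp hq hpq
        simp only [smul_eq_mul, map_add, map_smul] at this ⊢
        convert! this using 2
        linear_combination (b i) * hpq
      refine ⟨convex_univ, fun x hx y hy p q hp hq hpq => ?_⟩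
      simp only [smul_eq_mul, Finset.mul_sum, ← Finset.sum_add_distrib]
      exact Finset.sum_le_sum fun i hi => (this i hi).2 hx hy hp hq hpq
    · exact ((convexOn_norm convex_univ).pow (fun _ _ => norm_nonneg _) 2).smul hε.le
  · refine Metric.isCompact_of_isClosed_isBounded
      (isClosed_le hcd.continuous continuous_const) ?_
    refine (Metric.isBounded_closedBall (x := (0 : E n)) (r := Real.sqrt (c / ε))).subset ?_
    intro x hx
    rw [mem_closedBall_zero_iff]
    refine Real.le_sqrt_of_sq_le ?_
    rw [le_div_iff₀ hε]
    have h1 : 0 ≤ ∑ i ∈ T, Real.exp (ℓ i x - b i) :=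
      Finset.sum_nonneg fun i _ => (Real.exp_pos _).le
    have h2 : ∑ i ∈ T, Real.exp (ℓ i x - b i) + ε * ‖x‖ ^ 2 ≤ c := hx
    linarith
  · have h1 := (hasDerivAt_comp_segment isOpen_univ hcd.contDiffOn
      (mem_univ (x + (0 : ℝ) • v))).2
    have hl : HasDerivAt (fun t : ℝ => x + t • v) v 0 := by
      simpa using ((hasDerivAt_id (0 : ℝ)).smul_const v).const_add x
    have h2 : HasDerivAt (fun t : ℝ => fderiv ℝ (expSum T ℓ b ε) (x + t • v) v)
        (∑ i ∈ T, Real.exp (ℓ i (x + (0 : ℝ) • v) - b i) * ℓ i v * ℓ i v +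
          ε * (2 * inner ℝ v v)) 0 := by
      simp only [hfd]
      refine HasDerivAt.add (HasDerivAt.fun_sum fun i _ => ?_) ?_
      · exact ((((ℓ i).hasFDerivAt.comp_hasDerivAt 0 hl).sub_const (b i)).exp).mul_const _
      · have := ((hl.inner ℝ (hasDerivAt_const (0 : ℝ) v)).const_mul 2).const_mul ε
        simpa using this
    have h3 := h1.unique h2
    simp only [zero_smul, add_zero] at h3
    rw [h3, real_inner_self_eq_norm_sq]
    have h4 : 0 ≤ ∑ i ∈ T, Real.exp (ℓ i x - b i) * ℓ i v * ℓ i v :=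
      Finset.sum_nonneg fun i _ => by
        rw [mul_assoc]; exact mul_nonneg (Real.exp_pos _).le (mul_self_nonneg _)
    have h5 : 0 < ‖v‖ := norm_pos_iff.2 hv
    positivity

/-- A compact convex set can be approximated from outside by sublevel sets of convex exhaustions.
Finitely many half-spaces separate it from the boundary of a neighbourhood. -/
lemma exists_convexExhaustion {n : ℕ} {C U : Set (E n)} (hC : IsCompact C) (hCc : Convex ℝ C)
    (hC0 : C.Nonempty) (hU : IsOpen U) (hCU : C ⊆ U) :
    ∃ f : E n → ℝ, IsConvexExhaustion f ∧ (∀ x ∈ C, f x < 1) ∧ {x | f x ≤ 1} ⊆ U := by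
  wlog hb : Bornology.IsBounded U generalizing U
  · obtain ⟨R, hR⟩ := hC.isBounded.subset_ball 0
    obtain ⟨f, h1, h2, h3⟩ := this (hU.inter Metric.isOpen_ball) (subset_inter hCU hR)
      (Metric.isBounded_ball.subset inter_subset_right)
    exact ⟨f, h1, h2, h3.trans inter_subset_left⟩
  have hF : IsCompact (frontier U) :=
    Metric.isCompact_of_isClosed_isBounded isClosed_frontier
      (hb.closure.subset frontier_subset_closure)
  have hsep : ∀ z : E n, ∃ (ℓ : E n →L[ℝ] ℝ) (b δ : ℝ),
      z ∈ frontier U → 0 < δ ∧ (∀ x ∈ C, ℓ x - b ≤ -δ) ∧ b < ℓ z := by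
    intro z
    by_cases hz : z ∈ frontier U
    · have hzC : z ∉ C := fun h => by
        rw [hU.frontier_eq] at hz
        exact hz.2 (hCU h)
      obtain ⟨ℓ, b, h1, h2⟩ := geometric_hahn_banach_closed_point hCc hC.isClosed hzC
      obtain ⟨y, hy, hmax⟩ := hC.exists_isMaxOn hC0 ℓ.continuous.continuousOn
      refine ⟨ℓ, b, b - ℓ y, fun _ => ⟨sub_pos.2 (h1 y hy), fun x hx => ?_, h2⟩⟩
      have : ℓ x ≤ ℓ y := hmax hx
      linarith
    · exact ⟨0, 0, 0, fun h => absurd h hz⟩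
  choose ℓ b δ hℓ using hsep
  obtain ⟨T, hTF, hT⟩ := hF.elim_nhds_subcover (fun z => {x | b z < ℓ z x})
    (fun z hz => (isOpen_lt continuous_const (ℓ z).continuous).mem_nhds (hℓ z hz).2.2)
  obtain ⟨R, hR⟩ := hC.isBounded.exists_norm_le
  -- Steep exponentials and a flat quadratic term are uniformly small on `C`.
  have hlim : Tendsto (fun m : ℝ => ∑ z ∈ T, Real.exp (-(m * δ z)) + m⁻¹ * R ^ 2) atTop
      (𝓝 0) := by
    have h1 : Tendsto (fun m : ℝ => ∑ z ∈ T, Real.exp (-(m * δ z))) atTop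
        (𝓝 (∑ z ∈ T, (0 : ℝ))) := by
      refine tendsto_finsetSum T fun z hz => Real.tendsto_exp_neg_atTop_nhds_zero.comp ?_
      exact tendsto_id.atTop_mul_const (hℓ z (hTF z hz)).1
    simpa using h1.add (tendsto_inv_atTop_zero.mul_const (R ^ 2))
  obtain ⟨m, hm1, hm⟩ := ((hlim.eventually (gt_mem_nhds zero_lt_one)).and
    (eventually_gt_atTop 0)).exists
  have hexh := isConvexExhaustion_expSum T (fun z => m • ℓ z) (fun z => m * b z) (inv_pos.2 hm)
  refine ⟨_, hexh, fun x hx => ?_, ?_⟩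
  · refine lt_of_le_of_lt ?_ hm1
    unfold expSum
    gcongr with z hz
    · have := mul_le_mul_of_nonneg_left ((hℓ z (hTF z hz)).2.1 x hx) hm.le
      simp only [smul_apply, smul_eq_mul]
      linarith
    · exact hR x hx
  · have hpre : IsPreconnected {x | expSum T (fun z => m • ℓ z) (fun z => m * b z) m⁻¹ x ≤ 1} := by
      simpa using (hexh.convexOn.convex_le 1).isPreconnected
    obtain ⟨y, hy⟩ := hC0
    have hy1 : expSum T (fun z => m • ℓ z) (fun z => m * b z) m⁻¹ y ≤ 1 := by
      refine le_trans ?_ hm1.le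
      unfold expSum
      gcongr with z hz
      · have := mul_le_mul_of_nonneg_left ((hℓ z (hTF z hz)).2.1 y hy) hm.le
        simp only [smul_apply, smul_eq_mul]
        linarith
      · exact hR y hy
    refine hpre.subset_left_of_subset_union hU isClosed_closure.isOpen_compl
      (disjoint_compl_right.mono_left subset_closure) ?_ ⟨y, hy1, hCU hy⟩
    intro x hx1
    by_contra hxU
    have hxF : x ∈ frontier U := by
      rw [hU.frontier_eq]
      exact ⟨by_contra fun h => hxU (Or.inr h), fun h => hxU (Or.inl h)⟩
    obtain ⟨z, hz, hzx⟩ := mem_iUnion₂.1 (hT hxF)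
    have hzx' : b z < ℓ z x := hzx
    have h1 : 1 < Real.exp ((m • ℓ z) x - m * b z) := by
      rw [Real.one_lt_exp_iff]
      simp only [smul_apply, smul_eq_mul]
      nlinarith
    have h2 := Finset.single_le_sum (f := fun z => Real.exp ((m • ℓ z) x - m * b z))
      (fun i _ => (Real.exp_pos _).le) hz
    have h3 : 0 ≤ m⁻¹ * ‖x‖ ^ 2 := by positivity
    have h4 : expSum T (fun z => m • ℓ z) (fun z => m * b z) m⁻¹ x ≤ 1 := hx1
    unfold expSum at h4
    linarith

namespace IsConvexExhaustion

variable {n : ℕ} {f : E n → ℝ}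

lemma convex (hf : IsConvexExhaustion f) (c : ℝ) : Convex ℝ {x | f x ≤ c} := by
  simpa using hf.convexOn.convex_le c

lemma fderiv_ne_zero (hf : IsConvexExhaustion f) {x₀ x : E n} (h : f x₀ < f x) :
    fderiv ℝ f x ≠ 0 := by
  intro h0
  have hd : DifferentiableAt ℝ f x := hf.contDiff.differentiable (by norm_num) x
  have hl : HasDerivAt (fun t : ℝ => AffineMap.lineMap x x₀ t) (x₀ - x) 0 :=
    AffineMap.hasDerivAt_lineMap
  have hg : HasDerivAt (fun t : ℝ => f (AffineMap.lineMap x x₀ t)) 0 0 := by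
    have hd' : HasFDerivAt f (fderiv ℝ f x) (AffineMap.lineMap x x₀ (0 : ℝ)) := by
      simpa using hd.hasFDerivAt
    have := hd'.comp_hasDerivAt (0 : ℝ) hl
    rwa [h0, zero_apply] at this
  have hc : ConvexOn ℝ univ (fun t : ℝ => f (AffineMap.lineMap x x₀ t)) :=
    hf.convexOn.comp_affineMap (AffineMap.lineMap x x₀)
  have := hc.le_slope_of_hasDerivAt (mem_univ 0) (mem_univ 1) zero_lt_one hg
  simp [slope_def_field] at this
  linarith

/-- Traces on `Ω` of sublevel sets of convex exhaustions are competitors in the convex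
isoperimetric profile. -/
lemma isCompetitor (hf : IsConvexExhaustion f) {Ω : Set (E n)} (hΩc : IsClosed Ω)
    (hΩ : Convex ℝ Ω) {c : ℝ} {x₀ : E n} (hx₀ : f x₀ < c)
    (hint : (interior ({x | f x ≤ c} ∩ Ω)).Nonempty) :
    IsCompetitor Ω ({x | f x ≤ c} ∩ Ω) := by
  have hcompact : IsCompact ({x | f x ≤ c} ∩ Ω) := (hf.isCompact c).inter_right hΩc
  refine ⟨inter_subset_right, hcompact, (hf.convex c).inter hΩ, hint, ?_⟩
  rintro x ⟨⟨hxΩ, hx1⟩, hx2⟩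
  rw [hcompact.isClosed.closure_eq] at hx1
  have hx3 : c ≤ f x := by
    have hcl : IsClosed {y | c ≤ f y} := isClosed_le continuous_const hf.contDiff.continuous
    refine closure_minimal ?_ hcl hx2
    rintro y ⟨hyΩ, hy⟩
    by_contra h
    have hle : f y ≤ c := (not_le.1 (show ¬ c ≤ f y from h)).le
    exact hy ⟨hle, hyΩ⟩
  have hfx : f x = c := le_antisymm hx1.1 hx3
  have hD : fderiv ℝ (fun y => f y - c) = fderiv ℝ f := by
    funext y
    exact fderiv_sub_const c
  refine ⟨univ, fun y => f y - c, ⟨isOpen_univ, mem_univ x,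
    (hf.contDiff.sub contDiff_const).contDiffOn, by simp [hfx], ?_, ?_⟩, ?_⟩
  · rw [hD]
    exact hf.fderiv_ne_zero (x₀ := x₀) (by rwa [hfx])
  · ext y
    simp [and_comm]
  · intro v hv _
    unfold secondFF
    rw [hD]
    exact div_pos (hf.hessian_pos x v hv) (norm_pos_iff.2 (hf.fderiv_ne_zero (x₀ := x₀)
      (by rwa [hfx])))

lemma volume_level (hf : IsConvexExhaustion f) {c : ℝ} {x₀ : E n} (hx₀ : f x₀ < c) :
    volume {x | f x = c} = 0 := by
  have hcont := hf.contDiff.continuous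
  have hconv : Convex ℝ {x | f x < c} := by simpa using hf.convexOn.convex_lt c
  refine measure_mono_null (fun x (hx : f x = c) => ?_) (hconv.addHaar_frontier volume)
  rw [(isOpen_lt hcont continuous_const).frontier_eq]
  refine ⟨?_, fun h => (ne_of_lt h) hx⟩
  -- Points on the half-open segment from `x` to `x₀` lie strictly below the level `c`.
  have hlim : Tendsto (fun t : ℝ => (1 - t) • x + t • x₀) (𝓝[>] 0) (𝓝 x) := by
    have : Continuous fun t : ℝ => (1 - t) • x + t • x₀ := by fun_prop
    have h := this.tendsto 0
    simp only [sub_zero, one_smul, zero_smul, add_zero] at h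
    exact h.mono_left nhdsWithin_le_nhds
  refine mem_closure_of_tendsto hlim ?_
  filter_upwards [Ioo_mem_nhdsGT zero_lt_one] with t ht
  have := hf.convexOn.2 (mem_univ x) (mem_univ x₀) (sub_pos.2 ht.2).le ht.1.le (by ring)
  refine this.trans_lt ?_
  rw [smul_eq_mul, smul_eq_mul, hx]
  nlinarith [ht.1]

/-- The measures of the sublevel sets take all intermediate values: they are right-continuous in the
level because the sets are compact, and left-continuous because the level sets are null. -/
lemma exists_measure_eq (hf : IsConvexExhaustion f) {μ : Measure (E n)}
    [IsLocallyFiniteMeasure μ] (hμ : μ ≪ volume) {c₀ c₁ : ℝ} {x₀ : E n} (hx₀ : f x₀ < c₀)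
    {v : ℝ≥0∞} (h₀ : μ {x | f x ≤ c₀} ≤ v) (hc : c₀ ≤ c₁) (h₁ : v ≤ μ {x | f x ≤ c₁}) :
    ∃ c, c₀ ≤ c ∧ μ {x | f x ≤ c} = v := by
  set S := {c | c₀ ≤ c ∧ v ≤ μ {x | f x ≤ c}} with hS
  have hSne : S.Nonempty := ⟨c₁, hc, h₁⟩
  have hSb : BddBelow S := ⟨c₀, fun c hc => hc.1⟩
  set c := sInf S with hcdef
  have hc₀ : c₀ ≤ c := le_csInf hSne fun c hc => hc.1
  have hmono : ∀ a b : ℝ, a ≤ b → {x | f x ≤ a} ⊆ {x | f x ≤ b} :=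
    fun a b hab x (hx : f x ≤ a) => hx.trans hab
  refine ⟨c, hc₀, le_antisymm ?_ ?_⟩
  · have e : {x | f x ≤ c} ⊆ {x | f x = c} ∪ ⋃ k : ℕ, {x | f x ≤ c - 1 / (k + 1)} := by
      intro x (hx : f x ≤ c)
      rcases hx.eq_or_lt with h | h
      · exact Or.inl h
      · obtain ⟨k, hk⟩ := exists_nat_one_div_lt (sub_pos.2 h)
        exact Or.inr (mem_iUnion.2 ⟨k, by
          rw [mem_ofPred_eq]; linarith⟩)
    refine (measure_mono e).trans ((measure_union_le _ _).trans ?_)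
    rw [hμ (hf.volume_level (hx₀.trans_le hc₀)), zero_add, Monotone.measure_iUnion]
    · refine iSup_le fun k => ?_
      have hk : (0 : ℝ) < 1 / (k + 1) := by positivity
      by_cases h : c₀ ≤ c - 1 / (k + 1)
      · by_contra hlt
        have := csInf_le hSb (show c - 1 / ((k : ℝ) + 1) ∈ S from ⟨h, (not_le.1 hlt).le⟩)
        linarith
      · exact (measure_mono (hmono _ _ (not_le.1 h).le)).trans h₀
    · intro i j hij
      refine hmono _ _ ?_
      gcongr
  · have e : {x | f x ≤ c} = ⋂ k : ℕ, {x | f x ≤ c + 1 / (k + 1)} := by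
      ext x
      simp only [mem_ofPred_eq, mem_iInter]
      refine ⟨fun h k => h.trans (by have : (0 : ℝ) < 1 / (k + 1) := by positivity
                                     linarith), fun h => ?_⟩
      refine le_of_forall_pos_lt_add fun ε hε => ?_
      obtain ⟨k, hk⟩ := exists_nat_one_div_lt hε
      have := h k
      linarith
    have hlim : Tendsto (μ ∘ fun k : ℕ => {x | f x ≤ c + 1 / ((k : ℝ) + 1)}) atTop
        (𝓝 (μ (⋂ k : ℕ, {x | f x ≤ c + 1 / ((k : ℝ) + 1)}))) := by
      refine tendsto_measure_iInter_atTop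
        (fun k => (hf.isCompact _).measurableSet.nullMeasurableSet) ?_
        ⟨0, (hf.isCompact _).measure_ne_top⟩
      intro i j hij
      refine hmono _ _ ?_
      gcongr
    rw [e]
    refine ge_of_tendsto hlim (Eventually.of_forall fun k => ?_)
    have hk : (0 : ℝ) < 1 / (k + 1) := by positivity
    obtain ⟨b, hb, hbc⟩ := exists_lt_of_csInf_lt hSne (show sInf S < c + 1 / ((k : ℝ) + 1) by
      linarith)
    exact hb.2.trans (measure_mono (hmono _ _ hbc.le))

end IsConvexExhaustion

/-! ### Monotonicity of the convex isoperimetric profile -/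

section Profile

variable {n : ℕ} {κ : ℝ} {μ : Measure (E n)} {K L : Set (E n)}

/-- Concavity bounds the growth of a convex set `M` that contains `K + sL` by the growth from `K`
to `M`, although `M` itself need not be of the form `K + sL`. -/
lemma nPow_growth_le (hBM : HasBrunnMinkowski κ μ) (h : IsGrowthPair μ L K) {M : Set (E n)}
    (hM : IsCompact M) (hMc : Convex ℝ M) {s r : ℝ} (hs : 0 < s) (hr : 0 < r)
    (hKM : K + s • L ⊆ M) :
    (nPow κ (μ.real (M + r • L)) - nPow κ (μ.real M)) / r ≤
      (nPow κ (μ.real M) - nPow κ (μ.real K)) / s := by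
  have hsr : 0 < s + r := by positivity
  have hKM' : K ⊆ M := (subset_enlargement h.zero_mem s).trans hKM
  have hlam : s / (s + r) ∈ Ioo (0 : ℝ) 1 := ⟨by positivity, by rw [div_lt_one hsr]; linarith⟩
  have e1 : 1 - s / (s + r) = r / (s + r) := by field_simp; ring
  have key := (hBM (s / (s + r)) hlam K (M + r • L) M h.isCompact
    (isCompact_enlargement hM h.isCompact' r) hM (by
      rintro k hk _ ⟨m, hm, _, ⟨l, hl, rfl⟩, rfl⟩
      have hkl : k + s • l ∈ M := hKM ⟨k, hk, _, ⟨l, hl, rfl⟩, rfl⟩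
      have := hMc hkl hm (sub_pos.2 hlam.2).le hlam.1.le (by ring)
      convert! this using 1
      rw [e1]
      simp only [smul_add, smul_smul]
      rw [show r / (s + r) * s = s / (s + r) * r by ring]
      abel) h.measure_pos
    (h.measure_pos.trans_le (measure_mono (hKM'.trans (subset_enlargement h.zero_mem r))))).2
  rw [e1] at key
  rw [div_le_div_iff₀ hr hs]
  have : r * nPow κ (μ.real K) + s * nPow κ (μ.real (M + r • L)) ≤
      (s + r) * nPow κ (μ.real M) := by
    have := mul_le_mul_of_nonneg_left key hsr.le
    calc _ = (s + r) * (r / (s + r) * nPow κ (μ.real K) +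
          s / (s + r) * nPow κ (μ.real (M + r • L))) := by field_simp
      _ ≤ _ := this
  linarith

lemma measure_pos_of_subset_support (hK : K ⊆ μ.support) (hint : (interior K).Nonempty) :
    0 < μ K := by
  obtain ⟨x, hx⟩ := hint
  exact (Measure.mem_support_iff_forall x).1 (hK (interior_subset hx)) K
    (mem_interior_iff_mem_nhds.1 hx)

lemma IsCompetitor.isGrowthPair (hK : IsCompetitor μ.support K) (hL : IsCompact L)
    (hLc : Convex ℝ L) (hL0 : (0 : E n) ∈ interior L) : IsGrowthPair μ L K :=
  ⟨hK.isCompact, hK.convex, measure_pos_of_subset_support hK.subset hK.interior_nonempty, hL, hLc,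
    interior_subset hL0⟩

variable [IsLocallyFiniteMeasure μ]

/-- A subset `K'` of full measure in a convex set `M ⊇ K + sL` has small boundary measure. -/
lemma boundaryMeasure_le (hBM : HasBrunnMinkowski κ μ) (h : IsGrowthPair μ L K)
    {M K' : Set (E n)} (hM : IsCompact M) (hMc : Convex ℝ M) {s : ℝ} (hs : 0 < s)
    (hKM : K + s • L ⊆ M) (h' : IsGrowthPair μ L K') (hK'M : K' ⊆ M) (hμ : μ K' = μ M) :
    boundaryMeasure μ L K' ≤ ENNReal.ofReal (μ.real K' ^ (1 - κ) *
      ((nPow κ (μ.real K') - nPow κ (μ.real K)) / s)) := by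
  rw [boundaryMeasure_eq hBM h', ENNReal.ofReal_mul (Real.rpow_nonneg measureReal_nonneg _)]
  refine mul_le_mul_right (iSup₂_le fun r (hr : 0 < r) => ENNReal.ofReal_le_ofReal ?_) _
  have e : μ.real K' = μ.real M := by rw [measureReal_def, hμ, measureReal_def]
  rw [e]
  refine le_trans ?_ (nPow_growth_le hBM h hM hMc hs hr hKM)
  gcongr
  refine nPow_le_nPow κ (h'.real_enlargement_pos r) (measureReal_mono (add_subset_add_right hK'M) ?_)
  exact (isCompact_enlargement hM h'.isCompact' r).measure_ne_top

/-- If `K + sL` has measure less than `v`, a competitor of measure `v` arises as the trace on the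
support of a smooth convex body containing `K + sL`. -/
lemma convexProfile_le_of_measure_lt (hBM : HasBrunnMinkowski κ μ) (hμ : μ ≪ volume)
    (hΩ : Convex ℝ μ.support) (hL : IsCompact L) (hLc : Convex ℝ L)
    (hL0 : (0 : E n) ∈ interior L) (hK : IsCompetitor μ.support K) {K₂ : Set (E n)}
    (hK₂ : IsCompact K₂) {s : ℝ} (hs : 0 < s) (hlt : μ (K + s • L) < μ K₂) :
    convexProfile μ μ.support L (μ K₂) ≤ ENNReal.ofReal (μ.real K₂ ^ (1 - κ) *
      ((nPow κ (μ.real K₂) - nPow κ (μ.real K)) / s)) := by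
  have h := hK.isGrowthPair hL hLc hL0
  obtain ⟨U, hCU, hU, hμU⟩ := (K + s • L).exists_isOpen_lt_of_lt _ hlt
  obtain ⟨x₀, hx₀⟩ := h.nonempty
  have hx₀' := subset_enlargement h.zero_mem s hx₀
  obtain ⟨f, hf, hf1, hfU⟩ := exists_convexExhaustion
    (isCompact_enlargement hK.isCompact hL s) (hK.convex.add (hLc.smul s)) ⟨x₀, hx₀'⟩ hU hCU
  obtain ⟨R, hR⟩ := (hK₂.image hf.contDiff.continuous).bddAbove
  obtain ⟨c, hc1, hc⟩ := hf.exists_measure_eq (c₁ := max 1 R) hμ (hf1 x₀ hx₀')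
    ((measure_mono hfU).trans hμU.le) (le_max_left _ _)
    (measure_mono fun x hx => (hR (mem_image_of_mem f hx)).trans (le_max_right _ _))
  set M := {x | f x ≤ c} with hM
  have hKM : K + s • L ⊆ M := fun x hx => (hf1 x hx).le.trans hc1
  have hKM' : K ⊆ M := (subset_enlargement h.zero_mem s).trans hKM
  have hK' : IsCompetitor μ.support (M ∩ μ.support) :=
    hf.isCompetitor μ.isClosed_support hΩ ((hf1 x₀ hx₀').trans_le hc1)
      (hK.interior_nonempty.mono (interior_mono (subset_inter hKM' hK.subset)))
  have hμK' : μ (M ∩ μ.support) = μ M := by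
    refine measure_congr ?_
    filter_upwards [μ.support_mem_ae] with x hx
    exact propext ⟨fun hx => hx.1, fun hxM => ⟨hxM, hx⟩⟩
  have hbd := boundaryMeasure_le hBM h (hf.isCompact c) (hf.convex c) hs hKM
    (hK'.isGrowthPair hL hLc hL0) inter_subset_left hμK'
  have e : μ.real (M ∩ μ.support) = μ.real K₂ := by
    rw [measureReal_def, hμK', hc, measureReal_def]
  rw [e] at hbd
  exact (iInf₂_le (M ∩ μ.support) ⟨hK', hμK'.trans hc⟩).trans hbd

/-- The comparison behind the monotonicity of the profile. Let `t` be the time at which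
`μ (K + tL)` reaches `μ K₂`. The profile at `μ K₂` is bounded by the mean slope of
`N μ(K + tL)^{1/N}` over `[0, t]`, hence by its initial slope. -/
lemma convexProfile_le (hBM : HasBrunnMinkowski κ μ) (hμ : μ ≪ volume)
    (hΩ : Convex ℝ μ.support) (hL : IsCompact L) (hLc : Convex ℝ L)
    (hL0 : (0 : E n) ∈ interior L) (hK : IsCompetitor μ.support K) {K₂ : Set (E n)}
    (hK₂ : IsCompact K₂) (hlt : μ K < μ K₂) :
    convexProfile μ μ.support L (μ K₂) ≤ ENNReal.ofReal (μ.real K₂ ^ (1 - κ)) *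
      ⨆ t ∈ Ioi (0 : ℝ),
        ENNReal.ofReal ((nPow κ (μ.real (K + t • L)) - nPow κ (μ.real K)) / t) := by
  have h := hK.isGrowthPair hL hLc hL0
  set Δ := nPow κ (μ.real K₂) - nPow κ (μ.real K) with hΔ
  set S := {t : ℝ | 0 < t ∧ μ (K + t • L) < μ K₂} with hS
  have hSne : S.Nonempty := by
    have hlt' : μ.real K < μ.real K₂ :=
      (ENNReal.toReal_lt_toReal h.isCompact.measure_ne_top hK₂.measure_ne_top).2 hlt
    obtain ⟨t, ht, ht0⟩ := ((h.tendsto_real_enlargement.eventually (gt_mem_nhds hlt')).and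
      self_mem_nhdsWithin).exists
    exact ⟨t, ht0, (ENNReal.toReal_lt_toReal
      (isCompact_enlargement h.isCompact hL t).measure_ne_top hK₂.measure_ne_top).1 ht⟩
  have hSb : BddAbove S := by
    obtain ⟨k, hk⟩ := h.nonempty
    obtain ⟨c, hc, hcK⟩ := exists_forall_subset_smul
      (K := K₂ + {-k}) (hK₂.add isCompact_singleton) hL0
    refine ⟨c, fun t ht => le_of_not_gt fun hct => ht.2.not_ge (measure_mono fun x hx => ?_)⟩
    exact ⟨k, hk, x + -k, hcK t hct.le ⟨x, hx, -k, rfl, rfl⟩, by simp⟩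
  set T := sSup S with hT
  have hT0 : 0 < T := by
    obtain ⟨t, ht⟩ := hSne
    exact ht.1.trans_le (le_csSup hSb ht)
  have hbelow : convexProfile μ μ.support L (μ K₂) ≤
      ENNReal.ofReal (μ.real K₂ ^ (1 - κ) * (Δ / T)) := by
    have hlim : Tendsto (fun s : ℝ => ENNReal.ofReal (μ.real K₂ ^ (1 - κ) * (Δ / s))) (𝓝[<] T)
        (𝓝 (ENNReal.ofReal (μ.real K₂ ^ (1 - κ) * (Δ / T)))) := by
      refine (ENNReal.tendsto_ofReal ?_).mono_left nhdsWithin_le_nhds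
      exact (tendsto_const_nhds.div tendsto_id hT0.ne').const_mul _
    refine ge_of_tendsto hlim ?_
    filter_upwards [Ioo_mem_nhdsLT hT0] with s hs
    obtain ⟨t, ht, hst⟩ := exists_lt_of_lt_csSup hSne hs.2
    exact convexProfile_le_of_measure_lt hBM hμ hΩ hL hLc hL0 hK hK₂ hs.1
      ((measure_mono (enlargement_mono hLc h.zero_mem hs.1.le hst.le)).trans_lt ht.2)
  have habove : ENNReal.ofReal (Δ / T) ≤ ⨆ t ∈ Ioi (0 : ℝ),
      ENNReal.ofReal ((nPow κ (μ.real (K + t • L)) - nPow κ (μ.real K)) / t) := by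
    have hlim : Tendsto (fun s : ℝ => ENNReal.ofReal (Δ / s)) (𝓝[>] T)
        (𝓝 (ENNReal.ofReal (Δ / T))) := by
      refine (ENNReal.tendsto_ofReal ?_).mono_left nhdsWithin_le_nhds
      exact tendsto_const_nhds.div tendsto_id hT0.ne'
    refine le_of_tendsto hlim ?_
    filter_upwards [self_mem_nhdsWithin] with s (hs : T < s)
    have hs0 : 0 < s := hT0.trans hs
    refine le_trans (ENNReal.ofReal_le_ofReal ?_) (le_iSup₂ (f := fun t (_ : t ∈ Ioi (0 : ℝ)) =>
      ENNReal.ofReal ((nPow κ (μ.real (K + t • L)) - nPow κ (μ.real K)) / t)) s hs0)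
    have hge : μ K₂ ≤ μ (K + s • L) := by
      by_contra hcon
      exact hs.not_ge (le_csSup hSb ⟨hs0, not_le.1 hcon⟩)
    have hK₂0 : 0 < μ.real K₂ :=
      ENNReal.toReal_pos (zero_le.trans_lt hlt).ne' hK₂.measure_ne_top
    have := nPow_le_nPow κ hK₂0
      (ENNReal.toReal_mono (isCompact_enlargement h.isCompact hL s).measure_ne_top hge)
    rw [hΔ]
    gcongr
    exact this
  rw [ENNReal.ofReal_mul (Real.rpow_nonneg measureReal_nonneg _)] at hbelow
  exact hbelow.trans (mul_le_mul_right habove _)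

theorem antitoneOn_convexProfile (hBM : HasBrunnMinkowski κ μ) (hμ : μ ≪ volume)
    (hΩ : Convex ℝ μ.support) (hL : IsCompact L) (hLc : Convex ℝ L)
    (hL0 : (0 : E n) ∈ interior L) (hκ : κ < 1) :
    AntitoneOn (fun v : ℝ≥0∞ => convexProfile μ μ.support L v ^ (1 / (1 - κ)) / v)
      (profileDomain μ μ.support) := by
  rintro v₁ hv₁ v₂ ⟨K₂, hK₂, rfl⟩ hle
  rcases hle.eq_or_lt with rfl | hlt
  · exact le_rfl
  have hκ' : 0 < 1 - κ := sub_pos.2 hκ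
  have hv₁0 : v₁ ≠ 0 := by
    obtain ⟨K, hK, rfl⟩ := hv₁
    exact (hK.isGrowthPair hL hLc hL0).measure_pos.ne'
  have hv₁t : v₁ ≠ ∞ := hlt.ne_top
  have hv₂0 : μ K₂ ≠ 0 := (zero_le.trans_lt hlt).ne'
  have hv₂t : μ K₂ ≠ ∞ := hK₂.isCompact.measure_ne_top
  set v₂ := μ K₂ with hv₂
  set I := convexProfile μ μ.support L with hI
  have hpow : ∀ A : Set (E n), μ A ≠ 0 → μ A ≠ ∞ →
      ENNReal.ofReal (μ.real A ^ (1 - κ)) = μ A ^ (1 - κ) := by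
    intro A h0 ht
    rw [measureReal_def, ← ENNReal.ofReal_rpow_of_pos (ENNReal.toReal_pos h0 ht),
      ENNReal.ofReal_toReal ht]
  have key : I v₂ * v₁ ^ (1 - κ) / v₂ ^ (1 - κ) ≤ I v₁ := by
    refine le_iInf₂ fun K hK => ?_
    obtain ⟨hKc, hKv⟩ := hK
    have h := hKc.isGrowthPair hL hLc hL0
    have h1 := convexProfile_le hBM hμ hΩ hL hLc hL0 hKc hK₂.isCompact (by rwa [hKv])
    rw [boundaryMeasure_eq hBM h, hpow K (by rwa [hKv]) (by rwa [hKv]), hKv]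
    rw [hpow K₂ hv₂0 hv₂t, ← hv₂, ← hI] at h1
    refine ENNReal.div_le_of_le_mul ?_
    calc _ ≤ _ := mul_le_mul_left h1 _
      _ = _ := by ring
  have key2 := ENNReal.rpow_le_rpow key (show 0 ≤ 1 / (1 - κ) by positivity)
  rw [ENNReal.div_rpow_of_nonneg _ _ (by positivity), ENNReal.mul_rpow_of_nonneg _ _ (by positivity),
    ← ENNReal.rpow_mul, ← ENNReal.rpow_mul, mul_one_div_cancel hκ'.ne', ENNReal.rpow_one,
    ENNReal.rpow_one] at key2
  change I v₂ ^ (1 / (1 - κ)) / v₂ ≤ I v₁ ^ (1 / (1 - κ)) / v₁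
  rw [ENNReal.le_div_iff_mul_le (Or.inl hv₁0) (Or.inl hv₁t)]
  calc _ = I v₂ ^ (1 / (1 - κ)) * v₁ / v₂ := by
        simp only [div_eq_mul_inv]; ring
    _ ≤ _ := key2

end Profile

end CDIsop

theorem mainTheorem11 (n : ℕ) (hn : 1 ≤ n)
    -- `κ = 1/N` ranges over `(-∞, 1/n]`
    (κ : ℝ) (hκ : κ ≤ 1 / (n : ℝ))
    (μ : Measure (CDIsop.E n)) [IsLocallyFiniteMeasure μ]
    (Ω : Set (CDIsop.E n)) (hΩ : μ.support = Ω) (hconv : Convex ℝ Ω)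
    (hCD : CDIsop.SatisfiesCDZero κ Ω μ)
    (L : Set (CDIsop.E n)) (hL : CDIsop.IsStrictC2Body L) :
    -- (1) concavity
    (∀ K : Set (CDIsop.E n), K ⊆ Ω → CDIsop.IsStrictC2Body K →
      ConcaveOn ℝ {t : ℝ | 0 ≤ t ∧ 0 < μ (K + t • L)}
        (fun t : ℝ => CDIsop.nPow κ (μ.real (K + t • L)))) ∧
    ((0 : CDIsop.E n) ∈ interior L →
      (∀ K : Set (CDIsop.E n), K ⊆ Ω → CDIsop.IsStrictC2Body K →
        ConcaveOn ℝ (Ici (0 : ℝ)) (fun t : ℝ => CDIsop.nPow κ (μ.real (K + t • L)))) ∧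
      -- existence of the boundary measure as a limit
      (∀ K : Set (CDIsop.E n), K ⊆ Ω → CDIsop.IsStrictC2Body K ∨ CDIsop.IsCompetitor Ω K →
        Tendsto (fun t : ℝ => (μ (K + t • L) - μ K) / ENNReal.ofReal t) (𝓝[>] 0)
          (𝓝 (CDIsop.boundaryMeasure μ L K))) ∧
      -- (2) isoperimetric inequalities
      (∀ K : Set (CDIsop.E n), K ⊆ Ω → CDIsop.IsStrictC2Body K →
        (((μ.real K ^ (1 - κ) : ℝ) : EReal) *
            (⨆ t : ℝ, ⨆ _ : 0 < t,
              (((CDIsop.nPow κ (μ.real (K + t • L)) - CDIsop.nPow κ (μ.real K)) / t : ℝ) : EReal))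
          ≤ (CDIsop.boundaryMeasure μ L K : EReal)) ∧
        (∀ D : ℝ, 0 < D → Ω - Ω ⊆ D • L →
          ((1 / D * μ.real K ^ (1 - κ) *
              (CDIsop.nPow κ (μ.real Ω) - CDIsop.nPow κ (μ.real K)) : ℝ) : EReal)
            ≤ (CDIsop.boundaryMeasure μ L K : EReal)) ∧
        (μ Ω = ∞ → 0 ≤ κ →
          ((μ.real K ^ (1 - κ) : ℝ) : EReal) *
              limsup (fun t : ℝ => ((CDIsop.nPow κ (μ.real (t • L)) / t : ℝ) : EReal)) atTop
            ≤ (CDIsop.boundaryMeasure μ L K : EReal))) ∧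
      -- (3) the convex isoperimetric profile; `N/(N-1) = 1/(1-κ)`
      (κ < 1 →
        AntitoneOn (fun v : ℝ≥0∞ => CDIsop.convexProfile μ Ω L v ^ (1 / (1 - κ)) / v)
          (CDIsop.profileDomain μ Ω))) := by
  subst hΩ
  have hBM : CDIsop.HasBrunnMinkowski κ μ := hCD.hasBrunnMinkowski hn hκ hconv
  have hac : μ ≪ volume := by
    obtain ⟨V, -, hμ, -⟩ := hCD
    rw [hμ]
    exact (withDensity_absolutelyContinuous _ _).trans Measure.absolutelyContinuous_restrict
  have hLc : Convex ℝ L := hL.strictConvex.convex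
  refine ⟨fun K _ hK => CDIsop.concaveOn_nPow_enlargement hBM hK.isCompact
    hK.strictConvex.convex hL.isCompact hLc, fun hL0 => ?_⟩
  have hpair : ∀ K : Set (CDIsop.E n), K ⊆ μ.support → CDIsop.IsStrictC2Body K →
      CDIsop.IsGrowthPair μ L K := fun K hKΩ hK =>
    ⟨hK.isCompact, hK.strictConvex.convex,
      CDIsop.measure_pos_of_subset_support hKΩ hK.interior_nonempty, hL.isCompact, hLc,
      interior_subset hL0⟩
  refine ⟨fun K hKΩ hK => (hpair K hKΩ hK).concaveOn hBM, fun K hKΩ hK => ?_,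
    fun K hKΩ hK => ⟨?_, ?_, ?_⟩,
    CDIsop.antitoneOn_convexProfile hBM hac hconv hL.isCompact hLc hL0⟩
  · have h : CDIsop.IsGrowthPair μ L K :=
      hK.elim (hpair K hKΩ) fun hK => hK.isGrowthPair hL.isCompact hLc hL0
    rw [CDIsop.boundaryMeasure_eq hBM h]
    exact CDIsop.tendsto_boundary_quotient hBM h
  · exact CDIsop.le_boundaryMeasure_of_le hBM (hpair K hKΩ hK)
      (iSup₂_le fun t ht => CDIsop.coe_slope_le ht)
  · exact fun D hD hΩD => CDIsop.le_boundaryMeasure_of_diameter hBM (hpair K hKΩ hK) hD hKΩ hΩD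
  · exact fun _ _ => CDIsop.limsup_le_boundaryMeasure hBM (hpair K hKΩ hK) hL0
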